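/- Let $B$ be a unital complex algebra and let $(A,\varphi)$ be a noncommutative probability space over $B$: $A$ is a unital complex algebra containing $B$ with $1_A=1_B$, and $\varphi:A\to B$ is a linear map with $\varphi(b)=b$ and $\varphi(bxb')=b\,\varphi(x)\,b'$ for $b,b'\in B$, $x\in A$. Its cumulants $c_\varphi^{(n)}:A^{\otimes_B n}\to B$ ($n\ge 1$) are determined by the moment-cumulant formula $$\varphi(a_1\cdots a_n)=\sum_{\pi\in NC(n)}\widehat{c_\varphi}(\pi)(a_1\otimes\cdots\otimes a_n),$$ where $NC(n)$ is the set of noncrossing partitions of $\{1,\dots,n\}$ and $\widehat{c_\varphi}(\pi)$ is the nested evaluation of the $c_\varphi^{(k)}$ along the blocks of $\pi$: the values of inner blocks are inserted as elements of $B$ at their places between the arguments of outer blocks. Subsets $X_i\subset A$ ($i\in I$) are free over $B$ if $c_\varphi^{(n)}(a_1\otimes\cdots\otimes a_n)=0$ whenever $a_j$ belongs to the subalgebra generated by $B$ and $X_{i_j}$ for $j=1,\dots,n$ and the indices $i_1,\dots,i_n\in I$ are not all equal. For $b\in B$ the symmetric R-transform of $x_1,\dots,x_s\in A$ is the formal series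 $$R^{symm(b)}_{x_1,\dots,x_s}(z_1,\dots,z_s)=\sum_{n\ge1}\ \sum_{i_1,\dots,i_n\in\{1,\dots,s\}}c_\varphi^{(n)}(x_{i_1}\otimes b\,x_{i_2}\otimes\cdots\otimes b\,x_{i_n})\,z_{i_1}\cdots z_{i_n}$$ with coefficients in $B$, in noncommuting indeterminates $z_1,\dots,z_s$; the trivial R-transform $R^{t}$ is the case $b=1_B$. Let $p=p^2\in A$ commute with every element of $B$ and let $b_0=\varphi(p)$ be invertible in $B$ (it is then automatically central in $B$, and $b\mapsto bp$ is an injective unital homomorphism from $B$ into the algebra $pAp$ with unit $p$; we regard $B$ as a subalgebra of $pAp$ in this way). Then $\varphi_p=b_0^{-1}\,\varphi|_{pAp}:pAp\to B$ makes $(pAp,\varphi_p)$ a noncommutative probability space over $B$. Let $x_1,\dots,x_s\in A$ be such that $\{p\}$ and $\{x_1,\dots,x_s\}$ are free over $B$ in $(A,\varphi)$. Then the trivial R-transform of $px_1p,\dots,px_sp$ in $(pAp,\varphi_p)$ equals the symmetric R-transform by $b_0$ of $x_1,\dots,x_s$ in $(A,\varphi)$: $$R^{(\varphi_p):t}_{px_1p,\dots,px_sp}(z_1,\dots,z_s)=R^{symm(b_0)}_{x_1,\dots,x_s}(z_1,\dots,z_s).$$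 -/

import Mathlib

/-- A noncommutative probability space `(A, φ)` over a unital complex algebra `B`: a unital complex
algebra `A` containing `B` unitally (through `incl`, which is injective because of `φ_incl`), and a
conditional expectation (`B`-functional) `φ : A → B`. -/
structure NCProbSpace (B A : Type*) [Ring B] [Algebra ℂ B] [Ring A] [Algebra ℂ A] where
  /-- the inclusion `B ⊆ A`, with `1_B = 1_A` -/
  incl : B →ₐ[ℂ] A
  /-- the `B`-functional -/
  φ : A →ₗ[ℂ] B
  φ_incl : ∀ b, φ (incl b) = b
  φ_bimod : ∀ b x b', φ (incl b * x * incl b') = b * φ x * b'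

/-- A partition of a finite set of integers is noncrossing if there are no `i < j < k < l` such that
`i, k` lie in one block and `j, l` lie in another one. -/
def IsNoncrossing {T : Finset ℕ} (π : Finpartition T) : Prop :=
  ∀ V ∈ π.parts, ∀ W ∈ π.parts, ∀ i ∈ V, ∀ j ∈ W, ∀ k ∈ V, ∀ l ∈ W,
    i < j → j < k → k < l → V = W

open Classical in
/-- The noncrossing partitions of `{0, …, n - 1}`. -/
noncomputable def NC (n : ℕ) : Finset (Finpartition (Finset.range n)) :=
  {π | IsNoncrossing π}

namespace NCProbSpace

variable {B A : Type*} [Ring B] [Algebra ℂ B] [Ring A] [Algebra ℂ A]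

/-- The nested evaluation of a family of functionals `f⁽ᵏ⁾ : A^k → B` (given by `f` on lists of length
`k`) along the noncrossing partition `π`, on the letters `a_s`, `s ∈ S`, where `S` is a union of
blocks of `π`. If `V = {v₁ < ⋯ < v_k}` is the block of the least element of `S`, the result is
`f⁽ᵏ⁾(a_{v₁} e₁, …, a_{v_k} e_k)`, where `e_j` is the nested evaluation over the elements of `S`
lying between `v_j` and `v_{j+1}` (for `j = k`: after `v_k`). -/
noncomputable def nested (P : NCProbSpace B A) {T : Finset ℕ} (π : Finpartition T)
    (f : List A → B) (a : ℕ → A) (S : Finset ℕ) : B :=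
  if h : S.Nonempty then
    f (((π.part (S.min' h)).sort (· ≤ ·)).map fun v =>
      a v * P.incl (nested P π f a ((S.erase (S.min' h)).filter
        fun u => v < u ∧ ∀ w ∈ π.part (S.min' h), v < w → u < w)))
  else 1
termination_by S.card
decreasing_by
  exact (Finset.card_filter_le _ _).trans_lt (Finset.card_erase_lt_of_mem (S.min'_mem h))

/-- The extension of `f` to `π ∈ NC(n)`, evaluated at the tuple `l = (a₁, …, a_n)`. -/
noncomputable def multExt (P : NCProbSpace B A) (f : List A → B) (l : List A)
    (π : Finpartition (Finset.range l.length)) : B :=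
  P.nested π f (fun i => l.getD i 0) (Finset.range l.length)

/-- The cumulants `c⁽ⁿ⁾(a₁ ⊗ ⋯ ⊗ a_n)` of `(A, φ)`, determined by the moment-cumulant formula
`φ(a₁ ⋯ a_n) = ∑_{π ∈ NC(n)} ĉ(π)(a₁ ⊗ ⋯ ⊗ a_n)` (see `moment_eq_sum_multExt_cumulant`), which is
solved for the summand `c⁽ⁿ⁾(a₁ ⊗ ⋯ ⊗ a_n)` of the one-block partition; the other summands only
involve cumulants of lower order. -/
noncomputable def cumulant (P : NCProbSpace B A) (l : List A) : B :=
  P.φ l.prod - ∑ π ∈ NC l.length with 1 < π.parts.card,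
    P.multExt (fun l' => if l'.length < l.length then cumulant P l' else 0) l π
termination_by l.length

theorem nested_congr (P : NCProbSpace B A) {T : Finset ℕ} (π : Finpartition T) {f g : List A → B}
    (a : ℕ → A) (n : ℕ) (hfg : ∀ l, l.length < n → f l = g l) (hπ : ∀ i, (π.part i).card < n)
    (S : Finset ℕ) : P.nested π f a S = P.nested π g a S := by
  induction hS : S.card using Nat.strong_induction_on generalizing S with
  | _ N ih =>
    rw [nested, nested]
    split_ifs with h
    · rw [hfg _ (by simpa using hπ _)]
      congr 1
      refine List.map_congr_left fun v _ => ?_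
      rw [ih _ _ _ rfl]
      rw [← hS]
      exact (Finset.card_filter_le _ _).trans_lt (Finset.card_erase_lt_of_mem (S.min'_mem h))
    · rfl

theorem multExt_of_card_eq_one (P : NCProbSpace B A) (f : List A → B) (l : List A)
    (π : Finpartition (Finset.range l.length)) (h : π.parts.card = 1) :
    P.multExt f l π = f l := by
  obtain ⟨V, hV⟩ := Finset.card_eq_one.1 h
  have hVT : V = Finset.range l.length := by
    have := π.sup_parts
    rw [hV] at this
    simpa using this
  subst hVT
  have hne : (Finset.range l.length).Nonempty :=
    Finset.nonempty_iff_ne_empty.2 (π.ne_bot (by simp [hV]))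
  have hpart : π.part ((Finset.range l.length).min' hne) = Finset.range l.length :=
    π.part_eq_of_mem (by simp [hV]) (Finset.min'_mem _ _)
  rw [multExt, nested, dif_pos hne, hpart, Finset.sort_range]
  congr 1
  refine List.ext_getElem (by simp) fun i hi hi' => ?_
  have hempty : ((Finset.range l.length).erase ((Finset.range l.length).min' hne)).filter
      (fun u => i < u ∧ ∀ w ∈ Finset.range l.length, i < w → u < w) = ∅ := by
    refine Finset.filter_eq_empty_iff.2 fun u hu hu' => ?_
    exact lt_irrefl u (hu'.2 u (Finset.mem_of_mem_erase hu) hu'.1)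
  simp only [List.getElem_map, List.getElem_range]
  rw [hempty, nested, dif_neg (by simp), map_one, mul_one, List.getD_eq_getElem _ _ hi']

/-- The moment-cumulant formula `φ(a₁ ⋯ a_n) = ∑_{π ∈ NC(n)} ĉ(π)(a₁ ⊗ ⋯ ⊗ a_n)`, `n ≥ 1`. -/
theorem moment_eq_sum_multExt_cumulant (P : NCProbSpace B A) (l : List A) (hl : l ≠ []) :
    P.φ l.prod = ∑ π ∈ NC l.length, P.multExt P.cumulant l π := by
  classical
  have hpos : 0 < l.length := List.length_pos_iff.2 hl
  have hne : Finset.range l.length ≠ ⊥ := by simpa using hl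
  have hcard : ∀ π : Finpartition (Finset.range l.length), π.parts.card ≠ 0 := fun π h =>
    hne (π.parts_eq_empty_iff.1 (Finset.card_eq_zero.1 h))
  have h1 : ∑ π ∈ NC l.length with ¬ 1 < π.parts.card, P.multExt P.cumulant l π
      = P.cumulant l := by
    have hf : (NC l.length).filter (fun π => ¬ 1 < π.parts.card)
        = {Finpartition.indiscrete hne} := by
      ext π
      simp only [Finset.mem_filter, Finset.mem_singleton]
      constructor
      · rintro ⟨-, h⟩
        have h1 : π.parts.card = 1 := by have := hcard π; omega
        obtain ⟨V, hV⟩ := Finset.card_eq_one.1 h1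
        have hVT : V = Finset.range l.length := by
          have := π.sup_parts
          rw [hV] at this
          simpa using this
        ext1
        rw [hV, hVT, Finpartition.indiscrete_parts]
      · rintro rfl
        have hnc : IsNoncrossing (Finpartition.indiscrete hne) := fun V hV W hW _ _ _ _ _ _ _ _ _ _ _ => by
          rw [Finpartition.indiscrete_parts, Finset.mem_singleton] at hV hW
          rw [hV, hW]
        exact ⟨Finset.mem_filter.2 ⟨Finset.mem_univ _, hnc⟩, by simp⟩
    rw [hf, Finset.sum_singleton, multExt_of_card_eq_one _ _ _ _ (by simp)]
  have h2 : ∑ π ∈ NC l.length with 1 < π.parts.card, P.multExt P.cumulant l π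
      = ∑ π ∈ NC l.length with 1 < π.parts.card, P.multExt
        (fun l' => if l'.length < l.length then P.cumulant l' else 0) l π := by
    refine Finset.sum_congr rfl fun π hπ => ?_
    have hπ' := (Finset.mem_filter.1 hπ).2
    refine P.nested_congr π _ l.length (fun l' h => (if_pos h).symm) (fun i => ?_) _
    by_contra! hi
    have hi' : π.part i = Finset.range l.length :=
      Finset.eq_of_subset_of_card_le (π.part_subset i) (by simpa using hi)
    have hmem : i ∈ Finset.range l.length := by
      by_contra h
      rw [π.part_eq_empty.2 h] at hi'
      exact hne hi'.symm
    have hpm : π.part i ∈ π.parts := π.part_mem.2 hmem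
    have hall : ∀ V ∈ π.parts, V = π.part i := fun V hV => by
      obtain ⟨v, hv⟩ := Finset.nonempty_iff_ne_empty.2 (π.ne_bot hV)
      have hvi : v ∈ π.part i := by rw [hi']; exact π.le hV hv
      rw [← π.part_eq_of_mem hV hv, π.part_eq_of_mem hpm hvi]
    obtain ⟨V, hV, W, hW, hVW⟩ := Finset.one_lt_card.1 hπ'
    exact hVW ((hall V hV).trans (hall W hW).symm)
  rw [← Finset.sum_filter_add_sum_filter_not (NC l.length) (fun π => 1 < π.parts.card), h1, h2]
  rw [cumulant]
  abel

/-- A family of subalgebras of `A` (containing `B`) is free over `B` if all mixed cumulants of its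
elements vanish: `c⁽ⁿ⁾(a₁ ⊗ ⋯ ⊗ a_n) = 0` whenever `a_j ∈ A_{i_j}` for all `j` and the indices
`i₁, …, i_n` are not all equal. -/
def FreeSubalgebras (P : NCProbSpace B A) {ι : Type*} (𝒜 : ι → Subalgebra ℂ A) : Prop :=
  ∀ (n : ℕ) (i : Fin n → ι) (a : Fin n → A), (∀ j, a j ∈ 𝒜 (i j)) → (∃ j k, i j ≠ i k) →
    P.cumulant (List.ofFn a) = 0

/-- `Alg(X, B)`, the subalgebra of `A` generated by `B` and the subset `X`. -/
def algGen (P : NCProbSpace B A) (X : Set A) : Subalgebra ℂ A :=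
  Algebra.adjoin ℂ (X ∪ Set.range P.incl)

/-- A family of subsets `X_i` of `A` is free over `B` if the subalgebras `Alg(X_i, B)` are. -/
def FreeSets (P : NCProbSpace B A) {ι : Type*} (X : ι → Set A) : Prop :=
  P.FreeSubalgebras fun i => P.algGen (X i)

end NCProbSpace

/-- The formal series `∑_{n ≥ 1} ∑_{i₁, …, i_n} b_{i₁ … i_n} z_{i₁} ⋯ z_{i_n}` with coefficients in
`B` in `s` noncommuting indeterminates, given by their coefficients at the nonempty words. -/
abbrev BFormalSeries (B : Type*) (s : ℕ) : Type _ := {w : List (Fin s) // w ≠ []} → B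

namespace NCProbSpace

variable {B A : Type*} [Ring B] [Algebra ℂ B] [Ring A] [Algebra ℂ A]

/-- The tuple `(y₁, b y₂, …, b y_n)`. -/
def symmTuple (P : NCProbSpace B A) (b : B) : List A → List A
  | [] => []
  | y :: l => y :: l.map fun z => P.incl b * z

/-- The symmetric R-transform `R^{symm(b)}` of `x₁, …, x_s`, whose `(i₁, …, i_n)`-th coefficient is
the symmetric cumulant `c⁽ⁿ⁾(x_{i₁} ⊗ b x_{i₂} ⊗ ⋯ ⊗ b x_{i_n})`. -/
noncomputable def symmRTransform (P : NCProbSpace B A) (b : B) {s : ℕ} (x : Fin s → A) :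
    BFormalSeries B s :=
  fun w => P.cumulant (P.symmTuple b (w.1.map x))

/-- The trivial R-transform, which is the symmetric one for `b = 1_B`. -/
noncomputable def trivialRTransform (P : NCProbSpace B A) {s : ℕ} (x : Fin s → A) :
    BFormalSeries B s :=
  P.symmRTransform 1 x

end NCProbSpace

section Corner

variable {A : Type*} [Ring A] {p : A}

theorem corner_left (hp : IsIdempotentElem p) (x : hp.Corner) : p * x.1 = x.1 :=
  ((Subsemigroup.mem_corner_iff hp).1 x.2).1

theorem corner_right (hp : IsIdempotentElem p) (x : hp.Corner) : x.1 * p = x.1 :=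
  ((Subsemigroup.mem_corner_iff hp).1 x.2).2

variable [Algebra ℂ A]

/-- The complex algebra structure of the unital ring `pAp` (whose unit is `p`), with the scalar
multiplication of `A`. -/
noncomputable instance cornerSMul (hp : IsIdempotentElem p) : SMul ℂ hp.Corner where
  smul c x := ⟨c • x.1, (Subsemigroup.mem_corner_iff hp).2
    ⟨by rw [mul_smul_comm, corner_left], by rw [smul_mul_assoc, corner_right]⟩⟩

/-- The inclusion `pAp ⊆ A` as an additive map. -/
def cornerVal (hp : IsIdempotentElem p) : hp.Corner →+ A where
  toFun x := x.1
  map_zero' := rfl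
  map_add' _ _ := rfl

noncomputable instance cornerModule (hp : IsIdempotentElem p) : Module ℂ hp.Corner :=
  Function.Injective.module ℂ (cornerVal hp) Subtype.val_injective fun _ _ => rfl

noncomputable instance cornerAlgebra (hp : IsIdempotentElem p) : Algebra ℂ hp.Corner :=
  Algebra.ofModule (fun c x y => Subtype.ext (smul_mul_assoc c x.1 y.1))
    (fun c x y => Subtype.ext (mul_smul_comm c x.1 y.1))

/-- The compression `pxp ∈ pAp` of `x ∈ A`. -/
def compressElem (hp : IsIdempotentElem p) (x : A) : hp.Corner := ⟨p * x * p, x, rfl⟩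

end Corner

namespace NCProbSpace

variable {B A : Type*} [Ring B] [Algebra ℂ B] [Ring A] [Algebra ℂ A]

/-- If `p` commutes with `B`, then `φ(p)` is central in `B`. -/
theorem φ_central (P : NCProbSpace B A) {p : A} (hpB : ∀ b, Commute p (P.incl b)) (b : B) :
    P.φ p * b = b * P.φ p := by
  have h1 := P.φ_bimod 1 p b
  have h2 := P.φ_bimod b p 1
  simp only [map_one, one_mul, mul_one] at h1 h2
  rw [← h1, ← h2, (hpB b).eq]

/-- The compressed noncommutative probability space `(pAp, φ_p)` over `B`, where `p` is an
idempotent commuting with `B` such that `φ(p) = b₀` is invertible. The algebra `B` is contained in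
`pAp` through `b ↦ bp`, and `φ_p = b₀⁻¹ φ|_{pAp}`. -/
noncomputable def compress (P : NCProbSpace B A) {p : A} (hp : IsIdempotentElem p)
    (hpB : ∀ b, Commute p (P.incl b)) (b₀ : Bˣ) (hb₀ : P.φ p = b₀) :
    NCProbSpace B hp.Corner where
  incl := AlgHom.ofLinearMap
    { toFun := fun b => ⟨P.incl b * p, (Subsemigroup.mem_corner_iff hp).2
        ⟨by rw [← mul_assoc, (hpB b).eq, mul_assoc, hp.eq], by rw [mul_assoc, hp.eq]⟩⟩
      map_add' := fun b b' => Subtype.ext (by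
        change P.incl (b + b') * p = P.incl b * p + P.incl b' * p
        rw [map_add, add_mul])
      map_smul' := fun c b => Subtype.ext (by
        change P.incl (c • b) * p = c • (P.incl b * p)
        rw [map_smul, smul_mul_assoc]) }
    (Subtype.ext (by
      change P.incl 1 * p = p
      rw [map_one, one_mul]))
    (fun b b' => Subtype.ext (by
      change P.incl (b * b') * p = P.incl b * p * (P.incl b' * p)
      rw [mul_assoc (P.incl b), ← mul_assoc p, (hpB b').eq, mul_assoc (P.incl b'), hp.eq,
        map_mul, mul_assoc]))
  φ :=
    { toFun := fun x => ↑b₀⁻¹ * P.φ x.1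
      map_add' := fun x y => by
        change ↑b₀⁻¹ * P.φ (x.1 + y.1) = _
        rw [map_add, mul_add]
      map_smul' := fun c x => by
        change ↑b₀⁻¹ * P.φ (c • x.1) = _
        rw [map_smul, mul_smul_comm, RingHom.id_apply] }
  φ_incl b := by
    change ↑b₀⁻¹ * P.φ (P.incl b * p) = b
    have h := P.φ_bimod b p 1
    simp only [map_one, mul_one] at h
    rw [h, ← P.φ_central hpB, hb₀, Units.inv_mul_cancel_left]
  φ_bimod b x b' := by
    change ↑b₀⁻¹ * P.φ (P.incl b * p * x.1 * (P.incl b' * p)) = b * (↑b₀⁻¹ * P.φ x.1) * b'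
    have hx : P.incl b * p * x.1 * (P.incl b' * p) = P.incl b * x.1 * P.incl b' := by
      rw [← (hpB b').eq, mul_assoc _ p, corner_left, ← mul_assoc, mul_assoc _ x.1 p, corner_right]
    have hc : (b₀ : B) * b = b * b₀ := by rw [← hb₀, P.φ_central hpB]
    have hc' : (↑b₀⁻¹ : B) * b = b * ↑b₀⁻¹ := by
      rw [Units.inv_mul_eq_iff_eq_mul, ← mul_assoc, hc, Units.mul_inv_cancel_right]
    rw [hx, P.φ_bimod, mul_assoc b, ← mul_assoc _ b, hc']
    simp only [mul_assoc]

end NCProbSpace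

/-! ### The first-block recursion for cumulants -/

namespace NCProbSpace

variable {B A : Type*} [Ring B] [Algebra ℂ B] [Ring A] [Algebra ℂ A]

/-! Cumulants obey a recursion on the block of the first letter. Group the noncrossing partitions by
that block V: the gaps of V are partitioned independently, so φ(a₁ ⋯ aₙ) = ∑_V c(a_{v₁} φ(g₁), …,
a_{v_k} φ(g_k)), where g_j is the word between consecutive letters of V (`nestedSum_eq_sum_block`,
`cumulant_eq_firstBlockCumulant`). The recursion determines c, because the full block contributes
c(a₁, …, aₙ) and every other block has fewer arguments (`eq_of_blockSum_eq`).

Apply it to φ(y₁ p y₂ p ⋯ yₙ p), with the y_j in the algebra generated by B and the x_i. Mixed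
cumulants vanish, so the first block consists of y's only and each gap is a word p y p ⋯ y p
(`blockSum_interleave`), whose moment is a compressed moment times b₀. Every argument of a cumulant
thus ends in b₀. By balancedness over B, each b₀ but the last slides into the next argument, which
produces the symmetric cumulant, and the last one leaves on the right (`blockSum_mul_incl`).

On the other hand φ(p y₁ p ⋯ yₙ p) is the moment of the p y_j p in the compressed space, times b₀.
As φ need not be a trace, removing the leading p requires freeness: (1 - p) a p = 0 for a in the
algebra of p, and reduction to centered alternating words gives φ((1 - p) w p) = 0
(`FreeSubalgebras.φ_mul_mul_eq_zero`). After b₀ is cancelled, the symmetric cumulants satisfy the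
recursion of the compressed cumulants, so the two coincide. -/

theorem φ_incl_mul (P : NCProbSpace B A) (b : B) (x : A) : P.φ (P.incl b * x) = b * P.φ x := by
  simpa using P.φ_bimod b x 1

theorem φ_mul_incl (P : NCProbSpace B A) (x : A) (b : B) : P.φ (x * P.incl b) = P.φ x * b := by
  simpa using P.φ_bimod 1 x b

theorem φ_one (P : NCProbSpace B A) : P.φ 1 = 1 := by
  simpa using P.φ_incl 1

/-- The sum of `f(acc, a_{v₁} m(g₁), …, a_{v_k} m(g_k))` over all ways to choose letters
`a_{v₁}, …, a_{v_k}` of the word `a, g, rest`, the first of them being `a` and the others lying in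
`rest`, where `g_j` is the word of the letters between `a_{v_j}` and `a_{v_{j+1}}`. -/
def blockSum (P : NCProbSpace B A) (f m : List A → B) : List A → A → List A → List A → B
  | acc, a, g, [] => f (acc ++ [a * P.incl (m g)])
  | acc, a, g, x :: rest =>
    blockSum P f m acc a (g ++ [x]) rest + blockSum P f m (acc ++ [a * P.incl (m g)]) x [] rest

/-- The moment `φ(a₁ ⋯ a_n)`. -/
def moment (P : NCProbSpace B A) (l : List A) : B := P.φ l.prod

/-- The solution `c` of the moment-cumulant formula
`φ(a₁ ⋯ a_n) = ∑_V c(a_{v₁} φ(g₁), …, a_{v_k} φ(g_k))`, in which `V` is the block of the first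
letter. -/
noncomputable def firstBlockCumulant (P : NCProbSpace B A) : List A → B
  -- This value agrees with `cumulant []`, which is φ(1) minus an empty sum.
  | [] => 1
  | a :: l => P.moment (a :: l) - P.blockSum
      (fun l' => if l'.length < (a :: l).length then firstBlockCumulant P l' else 0)
      P.moment [] a [] l
termination_by l => l.length
decreasing_by assumption

theorem blockSum_congr (P : NCProbSpace B A) {f f' : List A → B} (m : List A → B)
    (acc : List A) (a : A) (g rest : List A)
    (h : ∀ l, l.length ≤ acc.length + 1 + rest.length → f l = f' l) :
    P.blockSum f m acc a g rest = P.blockSum f' m acc a g rest := by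
  induction rest generalizing acc a g with
  | nil => exact h _ (by simp)
  | cons x rest ih =>
    rw [blockSum, blockSum, ih, ih]
    · intro l hl
      refine h l ?_
      simp at hl ⊢
      omega
    · intro l hl
      refine h l ?_
      simp at hl ⊢
      omega

/-- Splitting off the summand of the full block. -/
theorem blockSum_eq_add (P : NCProbSpace B A) (f m : List A → B) (hm : m [] = 1)
    (acc : List A) (a : A) (rest : List A) :
    P.blockSum f m acc a [] rest = P.blockSum
      (fun l => if l.length < acc.length + 1 + rest.length then f l else 0) m acc a [] rest
      + f (acc ++ a :: rest) := by
  induction rest generalizing acc a with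
  | nil => simp [blockSum, hm]
  | cons x rest ih =>
    rw [blockSum, blockSum, ih, ← add_assoc]
    congr 1
    · congr 1
      · refine P.blockSum_congr _ _ _ _ _ fun l hl => ?_
        rw [if_pos]
        simp
        omega
      · refine P.blockSum_congr _ _ _ _ _ fun l hl => ?_
        have h : (acc ++ [a * P.incl (m [])]).length + 1 + rest.length =
          acc.length + 1 + (x :: rest).length := by simp; omega
        rw [h]
    · simp [hm]

theorem moment_nil (P : NCProbSpace B A) : P.moment [] = 1 := P.φ_one

/-- The length bound in `firstBlockCumulant` discards exactly the full block, which
`blockSum_eq_add` restores. -/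
theorem moment_cons_eq_blockSum (P : NCProbSpace B A) (a : A) (l : List A) :
    P.moment (a :: l) = P.blockSum P.firstBlockCumulant P.moment [] a [] l := by
  rw [P.blockSum_eq_add _ _ P.moment_nil, List.nil_append, firstBlockCumulant.eq_2]
  simp [add_comm]

/-! ### Additivity of the cumulants -/

/-- Functionals on lists that are additive in each entry. -/
def IsAdditive {B A : Type*} [Ring B] [Ring A] (f : List A → B) : Prop :=
  ∀ l₁ x y l₂, f (l₁ ++ (x + y) :: l₂) = f (l₁ ++ x :: l₂) + f (l₁ ++ y :: l₂)

theorem isAdditive_moment (P : NCProbSpace B A) : IsAdditive P.moment := fun l₁ x y l₂ => by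
  simp [moment, mul_add, add_mul]

theorem IsAdditive.eq_zero {B A : Type*} [Ring B] [Ring A] {f : List A → B} (hf : IsAdditive f) {l : List A} (h : 0 ∈ l) :
    f l = 0 := by
  obtain ⟨l₁, l₂, rfl⟩ := List.append_of_mem h
  simpa using hf l₁ 0 0 l₂

/-- During the recursion of `blockSum` a letter can be a settled argument, the current letter, part
of the current gap, or still unread. Each position gets its own additivity lemma, and the unread
case reduces to the other ones. -/
theorem IsAdditive.blockSum_acc (P : NCProbSpace B A) {f : List A → B} (hf : IsAdditive f)
    (m : List A → B) (l₁ : List A) (x y : A) (l₂ : List A) (a : A) (g rest : List A) :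
    P.blockSum f m (l₁ ++ (x + y) :: l₂) a g rest =
      P.blockSum f m (l₁ ++ x :: l₂) a g rest + P.blockSum f m (l₁ ++ y :: l₂) a g rest := by
  induction rest generalizing l₂ a g with
  | nil => simpa [blockSum] using hf l₁ x y (l₂ ++ [a * P.incl (m g)])
  | cons z rest ih =>
    simp only [blockSum, List.append_assoc, List.cons_append, ih]
    abel

theorem IsAdditive.blockSum_letter (P : NCProbSpace B A) {f : List A → B} (hf : IsAdditive f)
    (m : List A → B) (acc : List A) (x y : A) (g rest : List A) :
    P.blockSum f m acc (x + y) g rest =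
      P.blockSum f m acc x g rest + P.blockSum f m acc y g rest := by
  induction rest generalizing g with
  | nil => simp [blockSum, add_mul, hf acc _ _ []]
  | cons z rest ih =>
    simp only [blockSum, ih, add_mul, hf.blockSum_acc P m acc _ _ []]
    abel

theorem IsAdditive.blockSum_gap (P : NCProbSpace B A) {f m : List A → B} (hf : IsAdditive f)
    (hm : IsAdditive m) (acc : List A) (a : A) (g₁ : List A) (x y : A) (g₂ rest : List A) :
    P.blockSum f m acc a (g₁ ++ (x + y) :: g₂) rest =
      P.blockSum f m acc a (g₁ ++ x :: g₂) rest + P.blockSum f m acc a (g₁ ++ y :: g₂) rest := by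
  induction rest generalizing g₂ with
  | nil => simp [blockSum, mul_add, hm g₁, hf acc _ _ []]
  | cons z rest ih =>
    simp only [blockSum, List.append_assoc, List.cons_append, ih, hm g₁, map_add, mul_add,
      hf.blockSum_acc P m acc _ _ []]
    abel

theorem IsAdditive.blockSum_rest (P : NCProbSpace B A) {f m : List A → B} (hf : IsAdditive f)
    (hm : IsAdditive m) (acc : List A) (a : A) (g r₁ : List A) (x y : A) (r₂ : List A) :
    P.blockSum f m acc a g (r₁ ++ (x + y) :: r₂) =
      P.blockSum f m acc a g (r₁ ++ x :: r₂) + P.blockSum f m acc a g (r₁ ++ y :: r₂) := by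
  induction r₁ generalizing acc a g with
  | nil =>
    simp only [blockSum, List.nil_append, hf.blockSum_gap P hm acc a g _ _ [],
      hf.blockSum_letter P]
    abel
  | cons z r₁ ih =>
    simp only [blockSum, List.cons_append, ih]
    abel

theorem isAdditive_firstBlockCumulant (P : NCProbSpace B A) :
    IsAdditive P.firstBlockCumulant := by
  intro l₁ x y l₂
  induction hn : (l₁ ++ x :: l₂).length using Nat.strong_induction_on generalizing l₁ x y l₂ with
  | _ n ih =>
    -- Replacing one letter does not change the length, so truncation preserves additivity.
    have hf : IsAdditive fun l => if l.length < n then P.firstBlockCumulant l else 0 := by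
      intro k₁ z w k₂
      by_cases h : (k₁ ++ z :: k₂).length < n
      · have h' := ih _ h k₁ z w k₂ rfl
        simp only [List.length_append, List.length_cons] at h ⊢
        simp [h, h']
      · simp only [List.length_append, List.length_cons] at h ⊢
        simp [h]
    have hm := P.isAdditive_moment l₁ x y l₂
    cases l₁ with
    | nil =>
      simp only [List.nil_append, List.length_cons] at hn hm ⊢
      simp only [firstBlockCumulant.eq_2, List.length_cons, hn, hm, hf.blockSum_letter P]
      abel
    | cons z l₁ =>
      simp only [List.cons_append, List.length_cons, List.length_append] at hn hm ⊢
      simp only [firstBlockCumulant.eq_2, List.length_cons, List.length_append, hn, hm,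
        hf.blockSum_rest P P.isAdditive_moment]
      abel

/-! ### Balancedness over B -/

/-- The tuple `(a₁ b₁, …, a_n b_n)` of a list of pairs `(a_j, b_j)`. -/
def rightTuple (P : NCProbSpace B A) (l : List (A × B)) : List A :=
  l.map fun x => x.1 * P.incl x.2

/-- The tuple `(b a₁, b₁ a₂, …, b_{n-1} a_n)` of a list of pairs `(a_j, b_j)`. -/
def leftTuple (P : NCProbSpace B A) : B → List (A × B) → List A
  | _, [] => []
  | b, x :: l => (P.incl b * x.1) :: leftTuple P x.2 l

/-- The last coefficient `b_n` of a list of pairs `(a_j, b_j)`. -/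
def lastCoeff {B A : Type*} : B → List (A × B) → B
  | b, [] => b
  | _, x :: l => lastCoeff x.2 l

theorem leftTuple_append (P : NCProbSpace B A) (b : B) (l l' : List (A × B)) :
    P.leftTuple b (l ++ l') = P.leftTuple b l ++ P.leftTuple (lastCoeff b l) l' := by
  induction l generalizing b with
  | nil => rfl
  | cons x l ih => simp [leftTuple, lastCoeff, ih]

theorem lastCoeff_append {B A : Type*} (b : B) (l l' : List (A × B)) :
    lastCoeff b (l ++ l') = lastCoeff (lastCoeff b l) l' := by
  induction l generalizing b with
  | nil => rfl
  | cons x l ih => simp [lastCoeff, ih]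

theorem length_leftTuple (P : NCProbSpace B A) (b : B) (l : List (A × B)) :
    (P.leftTuple b l).length = l.length := by
  induction l generalizing b with
  | nil => rfl
  | cons x l ih => simp [leftTuple, ih]

/-- Functionals on lists that are balanced over `B` and right `B`-linear. -/
def IsBalanced (P : NCProbSpace B A) (f : List A → B) : Prop :=
  ∀ l : List (A × B), f (P.rightTuple l) = f (P.leftTuple 1 l) * lastCoeff 1 l

theorem prod_rightTuple (P : NCProbSpace B A) (b : B) (l : List (A × B)) :
    P.incl b * (P.rightTuple l).prod = (P.leftTuple b l).prod * P.incl (lastCoeff b l) := by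
  induction l generalizing b with
  | nil => simp [rightTuple, leftTuple, lastCoeff]
  | cons x l ih =>
    have h := ih x.2
    simp only [rightTuple, leftTuple, lastCoeff, List.map_cons, List.prod_cons, mul_assoc] at h ⊢
    rw [h]

theorem moment_rightTuple (P : NCProbSpace B A) (b : B) (l : List (A × B)) :
    b * P.moment (P.rightTuple l) = P.moment (P.leftTuple b l) * lastCoeff b l := by
  rw [moment, moment, ← φ_incl_mul, prod_rightTuple, φ_mul_incl]

/-- A coefficient b meeting a gap g is carried through it: b φ(g) = φ(g') b', where all coefficients
inside g have shifted by one letter and b' is the last of them. It leaves the gap just before the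
next chosen letter, so shifting is compatible with every choice of block. -/
theorem IsBalanced.blockSum {P : NCProbSpace B A} {f : List A → B} (hf : P.IsBalanced f)
    (acc : List (A × B)) (a : A) (b : B) (g rest : List (A × B)) :
    P.blockSum f P.moment (P.rightTuple acc) (a * P.incl b) (P.rightTuple g) (P.rightTuple rest) =
      P.blockSum f P.moment (P.leftTuple 1 acc) (P.incl (lastCoeff 1 acc) * a)
        (P.leftTuple b g) (P.leftTuple (lastCoeff b g) rest) *
        lastCoeff (lastCoeff b g) rest := by
  have key : ∀ (acc : List (A × B)) (a : A) (b : B) (g : List (A × B)),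
      P.rightTuple acc ++ [a * P.incl b * P.incl (P.moment (P.rightTuple g))] =
        P.rightTuple (acc ++ [(a * P.incl (P.moment (P.leftTuple b g)), lastCoeff b g)]) ∧
      P.leftTuple 1 acc ++ [P.incl (lastCoeff 1 acc) * a * P.incl (P.moment (P.leftTuple b g))] =
        P.leftTuple 1 (acc ++ [(a * P.incl (P.moment (P.leftTuple b g)), lastCoeff b g)]) := by
    intro acc a b g
    constructor
    · rw [mul_assoc, ← map_mul, moment_rightTuple]
      simp [rightTuple, mul_assoc]
    · simp [leftTuple_append, leftTuple, mul_assoc]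
  induction rest generalizing acc a b g with
  | nil =>
    have h := key acc a b g
    simp only [leftTuple, rightTuple, List.map_nil, NCProbSpace.blockSum] at h ⊢
    rw [h.1, h.2]
    have h' := hf (acc ++ [(a * P.incl (P.moment (P.leftTuple b g)), lastCoeff b g)])
    simpa only [lastCoeff_append, lastCoeff, rightTuple] using h'
  | cons x rest ih =>
    have h := key acc a b g
    have h1 := ih acc a b (g ++ [x])
    have h2 := ih (acc ++ [(a * P.incl (P.moment (P.leftTuple b g)), lastCoeff b g)]) x.1 x.2 []
    rw [← h.1, ← h.2] at h2
    simp only [leftTuple_append, lastCoeff_append, lastCoeff, leftTuple, rightTuple,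
      List.map_append, List.map_cons, List.map_nil, NCProbSpace.blockSum] at h1 h2 ⊢
    rw [h1, h2, add_mul]

theorem isBalanced_firstBlockCumulant (P : NCProbSpace B A) :
    P.IsBalanced P.firstBlockCumulant := by
  intro l
  induction hn : l.length using Nat.strong_induction_on generalizing l with
  | _ n ih =>
    have hf : P.IsBalanced fun l => if l.length < n then P.firstBlockCumulant l else 0 := by
      intro k
      by_cases h : k.length < n
      · simp [length_leftTuple, rightTuple, h]
        exact ih _ h k rfl
      · simp [length_leftTuple, rightTuple, h]
    cases l with
    | nil => simp [rightTuple, leftTuple, lastCoeff]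
    | cons x l =>
      have h1 := hf.blockSum [] x.1 x.2 [] l
      have h2 := P.moment_rightTuple 1 (x :: l)
      have h3 : (P.rightTuple l).length = l.length := by simp [rightTuple]
      simp only [leftTuple, lastCoeff, rightTuple, List.map_cons, List.map_nil, one_mul,
        map_one, List.length_cons] at h1 h2 h3 hn ⊢
      simp only [firstBlockCumulant.eq_2, List.length_cons, h3, length_leftTuple, hn, h1, h2, sub_mul]

end NCProbSpace

/-! ### Splitting noncrossing partitions along the block of the least element -/

open Classical in
/-- The noncrossing partitions of a finite set of integers. -/
noncomputable def noncrossingPartitions (T : Finset ℕ) : Finset (Finpartition T) :=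
  {π | IsNoncrossing π}

/-- The elements of `S` between `v` and the next element of `V`. -/
def gap (S V : Finset ℕ) (v : ℕ) : Finset ℕ :=
  S.filter fun u => v < u ∧ ∀ w ∈ V, v < w → u < w

theorem mem_gap {S V : Finset ℕ} {v u : ℕ} :
    u ∈ gap S V v ↔ u ∈ S ∧ v < u ∧ ∀ w ∈ V, v < w → u < w := by
  rw [gap, Finset.mem_filter]

theorem gap_subset (S V : Finset ℕ) (v : ℕ) : gap S V v ⊆ S := Finset.filter_subset _ _

theorem eq_of_mem_gap {S V : Finset ℕ} {v v' u : ℕ} (hv : v ∈ V) (hv' : v' ∈ V)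
    (h : u ∈ gap S V v) (h' : u ∈ gap S V v') : v = v' := by
  rw [mem_gap] at h h'
  by_contra hne
  rcases lt_or_gt_of_ne hne with hlt | hlt
  · exact lt_asymm (h.2.2 v' hv' hlt) h'.2.1
  · exact lt_asymm (h'.2.2 v hv hlt) h.2.1

theorem notMem_of_mem_gap {S V : Finset ℕ} {v u : ℕ} (h : u ∈ gap S V v) : u ∉ V := fun hu =>
  lt_irrefl u ((mem_gap.1 h).2.2 u hu (mem_gap.1 h).2.1)

theorem exists_mem_gap {S V : Finset ℕ} {m u : ℕ} (hm : m ∈ V) (hu : u ∈ S) (hmu : m < u)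
    (huV : u ∉ V) : ∃ v ∈ V, u ∈ gap S V v := by
  -- The gap containing u is the one after the largest element of V below u.
  have hne : (V.filter (· < u)).Nonempty := ⟨m, by simp [hm, hmu]⟩
  have h := Finset.max'_mem _ hne
  rw [Finset.mem_filter] at h
  refine ⟨_, h.1, mem_gap.2 ⟨hu, h.2, fun w hw hlt => ?_⟩⟩
  by_contra! hle
  have hwu : w < u := lt_of_le_of_ne hle fun h => huV (h ▸ hw)
  exact hlt.not_ge (Finset.le_max' _ _ (by simp [hw, hwu]))

/-- This is where noncrossing enters. An element j of the block of u to the left of the gap gives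
the crossing m < j < v < u; one to the right gives v < u < w < j with w in the block of m. -/
theorem part_subset_gap {S : Finset ℕ} {π : Finpartition S} (hπ : IsNoncrossing π) {m : ℕ}
    (hm : m ∈ S) (hmin : ∀ u ∈ S, m ≤ u) {v u : ℕ} (hv : v ∈ π.part m)
    (hu : u ∈ gap (S.erase m) (π.part m) v) :
    π.part u ⊆ gap (S.erase m) (π.part m) v := by
  have huS : u ∈ S := Finset.mem_of_mem_erase (gap_subset _ _ _ hu)
  have huV := notMem_of_mem_gap hu
  have hne : π.part m ≠ π.part u := fun h => huV (h ▸ π.mem_part huS)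
  have hmV := π.part_mem.2 hm
  have huP := π.part_mem.2 huS
  have hmm := π.mem_part hm
  have huu := π.mem_part huS
  have hdisj : ∀ {w}, w ∈ π.part m → w ∉ π.part u := fun {w} h h' =>
    hne (by rw [← π.part_eq_of_mem hmV h, ← π.part_eq_of_mem huP h'])
  obtain ⟨-, hvu, hnext⟩ := mem_gap.1 hu
  intro j hj
  have hjS : j ∈ S := π.part_subset _ hj
  have hjm : j ≠ m := fun h => hdisj hmm (h ▸ hj)
  have hmj : m < j := lt_of_le_of_ne (hmin j hjS) hjm.symm
  refine mem_gap.2 ⟨Finset.mem_erase.2 ⟨hjm, hjS⟩, ?_, fun w hw hvw => ?_⟩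
  · by_contra! hle
    have hjv : j < v := lt_of_le_of_ne hle fun h => hdisj hv (h ▸ hj)
    exact hne (hπ _ hmV _ huP m hmm j hj v hv u huu hmj hjv hvu)
  · by_contra! hle
    have hwj : w < j := lt_of_le_of_ne hle fun h => hdisj hw (h ▸ hj)
    exact hne (hπ _ hmV _ huP v hv u huu w hw j hj hvu (hnext w hw hvw) hwj)

theorem part_restrict {T S : Finset ℕ} (π : Finpartition S) (h : T ≤ S) {i : ℕ} (hi : i ∈ T) :
    (π.restrict h).part i = π.part i ∩ T := by
  have hiS := h hi
  have hmem : i ∈ π.part i ∩ T := Finset.mem_inter.2 ⟨π.mem_part hiS, hi⟩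
  refine Finpartition.part_eq_of_mem _ ?_ hmem
  rw [Finpartition.restrict, Finset.mem_erase]
  refine ⟨fun h0 => ?_, Finset.mem_image.2 ⟨_, π.part_mem.2 hiS, rfl⟩⟩
  rw [h0] at hmem
  simp at hmem

theorem IsNoncrossing.restrict {T S : Finset ℕ} {π : Finpartition S} (hπ : IsNoncrossing π)
    (h : T ≤ S) : IsNoncrossing (π.restrict h) := by
  intro V hV W hW i hi j hj k hk l hl hij hjk hkl
  simp only [Finpartition.restrict, Finset.mem_erase, Finset.mem_image] at hV hW
  obtain ⟨-, V', hV', rfl⟩ := hV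
  obtain ⟨-, W', hW', rfl⟩ := hW
  simp only [Finset.inf_eq_inter, Finset.mem_inter] at hi hj hk hl
  rw [hπ V' hV' W' hW' i hi.1 j hj.1 k hk.1 l hl.1 hij hjk hkl]

theorem finpartition_ext_part {S : Finset ℕ} {π π' : Finpartition S}
    (h : ∀ i ∈ S, π.part i = π'.part i) : π = π' := by
  have key : ∀ {ρ ρ' : Finpartition S}, (∀ i ∈ S, ρ.part i = ρ'.part i) → ρ.parts ⊆ ρ'.parts := by
    intro ρ ρ' h V hV
    obtain ⟨i, hi⟩ := ρ.nonempty_of_mem_parts hV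
    have hiS : i ∈ S := ρ.le hV hi
    rw [← ρ.part_eq_of_mem hV hi, h i hiS]
    exact ρ'.part_mem.2 hiS
  exact Finpartition.ext ((key h).antisymm (key fun i hi => (h i hi).symm))

/-- The partition of `S` consisting of the block `V` and of the blocks of partitions of the gaps
of `V`. -/
noncomputable def glue {S V : Finset ℕ} {m : ℕ} (hm : m ∈ V) (hVS : V ⊆ S)
    (hmin : ∀ u ∈ S, m ≤ u) (σ : ∀ v : V, Finpartition (gap (S.erase m) V v)) :
    Finpartition S :=
  Finpartition.ofExistsUnique (insert V (Finset.univ.biUnion fun v => (σ v).parts))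
    (fun p hp => by
      rcases Finset.mem_insert.1 hp with rfl | hp
      · exact hVS
      · obtain ⟨v, -, hv⟩ := Finset.mem_biUnion.1 hp
        exact ((σ v).le hv).trans ((gap_subset _ _ _).trans (Finset.erase_subset _ _)))
    (fun u hu => by
      by_cases huV : u ∈ V
      · refine ⟨V, ⟨Finset.mem_insert_self _ _, huV⟩, ?_⟩
        rintro p ⟨hp, hup⟩
        rcases Finset.mem_insert.1 hp with rfl | hp
        · rfl
        · obtain ⟨v, -, hv⟩ := Finset.mem_biUnion.1 hp
          exact absurd huV (notMem_of_mem_gap ((σ v).le hv hup))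
      · have hum : u ≠ m := fun h => huV (h ▸ hm)
        obtain ⟨v, hv, hgap⟩ := exists_mem_gap (S := S.erase m) hm
          (Finset.mem_erase.2 ⟨hum, hu⟩) (lt_of_le_of_ne (hmin u hu) hum.symm) huV
        refine ⟨(σ ⟨v, hv⟩).part u, ⟨Finset.mem_insert_of_mem (Finset.mem_biUnion.2
          ⟨⟨v, hv⟩, Finset.mem_univ _, (σ ⟨v, hv⟩).part_mem.2 hgap⟩),
          (σ ⟨v, hv⟩).mem_part hgap⟩, ?_⟩
        rintro p ⟨hp, hup⟩
        rcases Finset.mem_insert.1 hp with rfl | hp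
        · exact absurd hup huV
        · obtain ⟨⟨v', hv'⟩, -, hp⟩ := Finset.mem_biUnion.1 hp
          obtain rfl := eq_of_mem_gap hv hv' hgap ((σ ⟨v', hv'⟩).le hp hup)
          exact ((σ ⟨v, hv⟩).part_eq_of_mem hp hup).symm)
    (fun h => by
      rcases Finset.mem_insert.1 h with h | h
      · simp [← h] at hm
      · obtain ⟨v, -, hv⟩ := Finset.mem_biUnion.1 h
        exact (σ v).bot_notMem hv)

section Glue

variable {S V : Finset ℕ} {m : ℕ} (hm : m ∈ V) (hVS : V ⊆ S) (hmin : ∀ u ∈ S, m ≤ u)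
  (σ : ∀ v : V, Finpartition (gap (S.erase m) V v))

theorem mem_parts_glue {p : Finset ℕ} :
    p ∈ (glue hm hVS hmin σ).parts ↔ p = V ∨ ∃ v, p ∈ (σ v).parts := by
  simp [glue, Finpartition.ofExistsUnique]

theorem part_glue : (glue hm hVS hmin σ).part m = V :=
  Finpartition.part_eq_of_mem _ ((mem_parts_glue hm hVS hmin σ).2 (Or.inl rfl)) hm

theorem part_glue_of_mem_gap (v : V) {u : ℕ} (hu : u ∈ gap (S.erase m) V v) :
    (glue hm hVS hmin σ).part u = (σ v).part u :=
  Finpartition.part_eq_of_mem _ ((mem_parts_glue hm hVS hmin σ).2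
    (Or.inr ⟨v, (σ v).part_mem.2 hu⟩)) ((σ v).mem_part hu)

/-- Elements of one gap have no element of V between them, and distinct gaps are separated by
elements of V. A crossing can therefore only occur within a single gap. -/
theorem isNoncrossing_glue (hσ : ∀ v, IsNoncrossing (σ v)) :
    IsNoncrossing (glue hm hVS hmin σ) := by
  intro X hX Y hY i hi j hj k hk l hl hij hjk hkl
  rw [mem_parts_glue] at hX hY
  rcases hX with rfl | ⟨v, hX⟩ <;> rcases hY with rfl | ⟨v', hY⟩
  · rfl
  · have hj' := mem_gap.1 ((σ v').le hY hj)
    have hl' := mem_gap.1 ((σ v').le hY hl)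
    have := hl'.2.2 k hk (by omega)
    omega
  · have hi' := mem_gap.1 ((σ v).le hX hi)
    have hk' := mem_gap.1 ((σ v).le hX hk)
    have := hk'.2.2 j hj (by omega)
    omega
  · have hi' := mem_gap.1 ((σ v).le hX hi)
    have hk' := mem_gap.1 ((σ v).le hX hk)
    have hj' := mem_gap.1 ((σ v').le hY hj)
    have hl' := mem_gap.1 ((σ v').le hY hl)
    rcases lt_trichotomy v.1 v'.1 with h | h | h
    · have := hk'.2.2 _ v'.2 h
      omega
    · obtain rfl := Subtype.ext h
      exact hσ v X hX Y hY i hi j hj k hk l hl hij hjk hkl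
    · have := hl'.2.2 _ v.2 h
      omega

end Glue

/-! ### Summing nested evaluations gap by gap -/

namespace NCProbSpace

variable {B A : Type*} [Ring B] [Algebra ℂ B] [Ring A] [Algebra ℂ A]

theorem nested_of_nonempty (P : NCProbSpace B A) {T : Finset ℕ} (π : Finpartition T)
    (f : List A → B) (a : ℕ → A) {S : Finset ℕ} (h : S.Nonempty) :
    P.nested π f a S = f (((π.part (S.min' h)).sort (· ≤ ·)).map fun v => a v *
      P.incl (P.nested π f a (gap (S.erase (S.min' h)) (π.part (S.min' h)) v))) := by
  rw [nested, dif_pos h]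
  rfl

/-- It allows a partition to be replaced by its restriction to a gap. -/
theorem nested_congr_part (P : NCProbSpace B A) {T T' : Finset ℕ} (π : Finpartition T)
    (π' : Finpartition T') (f : List A → B) (a : ℕ → A) (S : Finset ℕ)
    (h : ∀ i ∈ S, π.part i = π'.part i) : P.nested π f a S = P.nested π' f a S := by
  induction hS : S.card using Nat.strong_induction_on generalizing S with
  | _ N ih =>
    by_cases hne : S.Nonempty
    · rw [nested_of_nonempty _ _ _ _ hne, nested_of_nonempty _ _ _ _ hne,
        h _ (S.min'_mem hne)]
      congr 1
      refine List.map_congr_left fun v _ => ?_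
      have hsub : ∀ V, gap (S.erase (S.min' hne)) V v ⊆ S.erase (S.min' hne) :=
        fun V => gap_subset _ _ _
      rw [ih _ _ _ (fun i hi => h i (Finset.mem_of_mem_erase (hsub _ hi))) rfl]
      rw [← hS]
      exact (Finset.card_le_card (hsub _)).trans_lt
        (Finset.card_erase_lt_of_mem (S.min'_mem hne))
    · rw [nested, nested, dif_neg hne, dif_neg hne]

/-- The sum over all noncrossing partitions of `S` of the nested evaluations. -/
noncomputable def nestedSum (P : NCProbSpace B A) (f : List A → B) (a : ℕ → A) (S : Finset ℕ) : B :=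
  ∑ π ∈ noncrossingPartitions S, P.nested π f a S

/-- The tuple `(a_v e_v)_{v ∈ V}`. -/
noncomputable def coeffTuple (P : NCProbSpace B A) (a : ℕ → A) (V : Finset ℕ) (e : V → B) :
    List A :=
  (V.sort (· ≤ ·)).map fun v => a v * P.incl (if h : v ∈ V then e ⟨v, h⟩ else 0)

/-- The sorted list of V has no repetitions, so a change of one coefficient affects exactly one
entry. -/
theorem exists_coeffTuple_update (P : NCProbSpace B A) (a : ℕ → A) (V : Finset ℕ)
    [DecidableEq V] (e : V → B) (v : V) : ∃ l₁ l₂ : List A, ∀ b : B,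
      P.coeffTuple a V (Function.update e v b) = l₁ ++ (a v * P.incl b) :: l₂ := by
  obtain ⟨k₁, k₂, hk⟩ := List.append_of_mem ((Finset.mem_sort (· ≤ ·)).2 v.2)
  have hnd := Finset.sort_nodup V (· ≤ ·)
  rw [hk, List.nodup_append] at hnd
  have h₁ : ∀ u ∈ k₁, u ≠ v.1 := fun u hu => hnd.2.2 u hu _ (List.mem_cons_self ..)
  have h₂ : ∀ u ∈ k₂, u ≠ v.1 := fun u hu huv => (List.nodup_cons.1 hnd.2.1).1 (huv ▸ hu)
  have h : ∀ k : List ℕ, (∀ u ∈ k, u ≠ v.1) → ∀ b : B, (k.map fun u =>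
      a u * P.incl (if h : u ∈ V then Function.update e v b ⟨u, h⟩ else 0)) = k.map fun u =>
      a u * P.incl (if h : u ∈ V then e ⟨u, h⟩ else 0) := fun k hk b =>
    List.map_congr_left fun u hu => by
      congr 2
      split_ifs
      · exact Function.update_of_ne (fun h => hk u hu (congrArg Subtype.val h)) _ _
      · rfl
  refine ⟨k₁.map fun u => a u * P.incl (if h : u ∈ V then e ⟨u, h⟩ else 0),
    k₂.map fun u => a u * P.incl (if h : u ∈ V then e ⟨u, h⟩ else 0), fun b => ?_⟩
  rw [coeffTuple, hk, List.map_append, List.map_cons, h k₁ h₁, h k₂ h₂]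
  simp

theorem IsAdditive.coeffTuple_update (P : NCProbSpace B A) {f : List A → B} (hf : IsAdditive f)
    (a : ℕ → A) (V : Finset ℕ) [DecidableEq V] (e : V → B) (v : V) (b b' : B) :
    f (P.coeffTuple a V (Function.update e v (b + b'))) =
      f (P.coeffTuple a V (Function.update e v b)) +
        f (P.coeffTuple a V (Function.update e v b')) := by
  obtain ⟨l₁, l₂, h⟩ := P.exists_coeffTuple_update a V e v
  simp only [h, map_add, mul_add, hf l₁]

/-- The evaluation of an additive functional at `(a_v e_v)_{v ∈ V}` as a multilinear map in the
coefficients `e_v ∈ B`. -/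
noncomputable def coeffMultilinear (P : NCProbSpace B A) {f : List A → B} (hf : IsAdditive f)
    (a : ℕ → A) (V : Finset ℕ) : MultilinearMap ℕ (fun _ : V => B) B where
  toFun e := f (P.coeffTuple a V e)
  map_update_add' e v b b' := hf.coeffTuple_update P a V e v b b'
  -- Over ℕ, homogeneity follows from additivity.
  map_update_smul' e v c b := map_nsmul (AddMonoidHom.mk'
    (fun b => f (P.coeffTuple a V (Function.update e v b))) (hf.coeffTuple_update P a V e v)) c b

theorem coeffMultilinear_apply (P : NCProbSpace B A) {f : List A → B} (hf : IsAdditive f)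
    (a : ℕ → A) (V : Finset ℕ) (e : V → B) :
    P.coeffMultilinear hf a V e = f ((V.sort (· ≤ ·)).map fun v =>
      a v * P.incl (if h : v ∈ V then e ⟨v, h⟩ else 0)) := rfl

/-- Noncrossing partitions with first block V correspond to families of noncrossing partitions of
the gaps, by restriction and `glue`. Multilinearity of f in the inserted coefficients then moves the
sum over families into the separate arguments. -/
theorem sum_nested_of_part_eq (P : NCProbSpace B A) {f : List A → B} (hf : IsAdditive f)
    (a : ℕ → A) {S V : Finset ℕ} (hS : S.Nonempty) (hVS : V ⊆ S) (hm : S.min' hS ∈ V) :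
    ∑ π ∈ noncrossingPartitions S with π.part (S.min' hS) = V, P.nested π f a S =
      f ((V.sort (· ≤ ·)).map fun v =>
        a v * P.incl (P.nestedSum f a (gap (S.erase (S.min' hS)) V v))) := by
  classical
  have hmin : ∀ u ∈ S, S.min' hS ≤ u := fun u hu => S.min'_le u hu
  set m := S.min' hS with hmdef
  have hmS : m ∈ S := S.min'_mem hS
  have hgap : ∀ v, gap (S.erase m) V v ≤ S := fun v =>
    (gap_subset _ _ _).trans (Finset.erase_subset _ _)
  -- By `part_subset_gap`, restriction to a gap cuts no block.
  have hpart : ∀ π : Finpartition S, IsNoncrossing π → π.part m = V → ∀ v ∈ V,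
      ∀ u ∈ gap (S.erase m) V v, (π.restrict (hgap v)).part u = π.part u := by
    rintro π hπ rfl v hv u hu
    rw [part_restrict _ _ hu]
    exact Finset.inter_eq_left.2 (part_subset_gap hπ hmS hmin hv hu)
  have hrhs : f ((V.sort (· ≤ ·)).map fun v =>
        a v * P.incl (P.nestedSum f a (gap (S.erase m) V v))) =
      P.coeffMultilinear hf a V fun v =>
        ∑ τ ∈ noncrossingPartitions (gap (S.erase m) V v), P.nested τ f a (gap (S.erase m) V v) := by
    rw [coeffMultilinear_apply]
    congr 1
    refine List.map_congr_left fun v hv => ?_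
    rw [dif_pos ((Finset.mem_sort _).1 hv)]
    rfl
  rw [hrhs, MultilinearMap.map_sum_finset]
  refine Finset.sum_bij (fun π _ v => π.restrict (hgap v)) ?_ ?_ ?_ ?_
  · intro π hπ
    simp only [noncrossingPartitions, Finset.mem_filter, Finset.mem_univ, true_and,
      Fintype.mem_piFinset] at hπ ⊢
    exact fun v => hπ.1.restrict _
  · intro π hπ π' hπ' h
    simp only [noncrossingPartitions, Finset.mem_filter, Finset.mem_univ, true_and] at hπ hπ'
    refine finpartition_ext_part fun u hu => ?_
    by_cases huV : u ∈ V
    · rw [π.part_eq_of_mem (hπ.2 ▸ π.part_mem.2 hmS) huV,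
        π'.part_eq_of_mem (hπ'.2 ▸ π'.part_mem.2 hmS) huV]
    · have hum : u ≠ m := fun h => huV (h ▸ hm)
      obtain ⟨v, hv, hg⟩ := exists_mem_gap (S := S.erase m) hm
        (Finset.mem_erase.2 ⟨hum, hu⟩) (lt_of_le_of_ne (hmin u hu) hum.symm) huV
      rw [← hpart π hπ.1 hπ.2 v hv u hg, ← hpart π' hπ'.1 hπ'.2 v hv u hg]
      exact congrArg (fun σ => σ.part u) (congrFun h ⟨v, hv⟩)
  · intro σ hσ
    simp only [noncrossingPartitions, Finset.mem_filter, Finset.mem_univ, true_and,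
      Fintype.mem_piFinset] at hσ
    have hnc := isNoncrossing_glue hm hVS hmin σ hσ
    have hp := part_glue hm hVS hmin σ
    refine ⟨glue hm hVS hmin σ, ?_, funext fun v => finpartition_ext_part fun u hu => ?_⟩
    · simp only [noncrossingPartitions, Finset.mem_filter, Finset.mem_univ, true_and]
      exact ⟨hnc, hp⟩
    · rw [hpart _ hnc hp v v.2 u hu, part_glue_of_mem_gap hm hVS hmin σ v hu]
  · intro π hπ
    simp only [noncrossingPartitions, Finset.mem_filter, Finset.mem_univ, true_and] at hπ
    rw [nested_of_nonempty _ _ _ _ hS, ← hmdef, hπ.2, coeffMultilinear_apply]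
    congr 1
    refine List.map_congr_left fun v hv => ?_
    have hv' := (Finset.mem_sort _).1 hv
    rw [dif_pos hv']
    congr 2
    exact P.nested_congr_part _ _ _ _ _ fun u hu => (hpart π hπ.1 hπ.2 v hv' u hu).symm

/-- The decomposition of noncrossing partitions along the block of the least element. -/
theorem nestedSum_eq_sum_block (P : NCProbSpace B A) {f : List A → B} (hf : IsAdditive f)
    (a : ℕ → A) {S : Finset ℕ} (hS : S.Nonempty) :
    P.nestedSum f a S = ∑ W ∈ (S.erase (S.min' hS)).powerset,
      f (((insert (S.min' hS) W).sort (· ≤ ·)).map fun v => a v *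
        P.incl (P.nestedSum f a (gap (S.erase (S.min' hS)) (insert (S.min' hS) W) v))) := by
  classical
  have hmS := S.min'_mem hS
  rw [nestedSum, ← Finset.sum_fiberwise_of_maps_to
    (t := (S.erase (S.min' hS)).powerset)
    (g := fun π => (π.part (S.min' hS)).erase (S.min' hS))
    (fun π _ => Finset.mem_powerset.2 (Finset.erase_subset_erase _ (π.part_subset _)))]
  refine Finset.sum_congr rfl fun W hW => ?_
  have hWS := Finset.mem_powerset.1 hW
  have hmW : S.min' hS ∉ W := fun h => Finset.notMem_erase _ _ (hWS h)
  rw [← P.sum_nested_of_part_eq hf a hS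
    (Finset.insert_subset hmS (hWS.trans (Finset.erase_subset _ _))) (Finset.mem_insert_self _ _)]
  refine Finset.sum_congr (Finset.filter_congr fun π _ => ?_) fun _ _ => rfl
  constructor
  · rintro rfl
    rw [Finset.insert_erase (π.mem_part hmS)]
  · rintro h
    rw [h, Finset.erase_insert hmW]

end NCProbSpace

/-! ### Identifying the two definitions of cumulants -/

theorem sort_eq_of_pairwise {s : Finset ℕ} {l : List ℕ} (hl : l.Pairwise (· < ·))
    (h : ∀ w, w ∈ s ↔ w ∈ l) : s.sort (· ≤ ·) = l := by
  obtain rfl : s = l.toFinset := Finset.ext fun w => by rw [h, List.mem_toFinset]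
  exact (List.toFinset_sort (· ≤ ·) (hl.imp ne_of_lt)).2 (hl.imp le_of_lt)

theorem pairwise_lt_sort (s : Finset ℕ) : (s.sort (· ≤ ·)).Pairwise (· < ·) :=
  (Finset.sortedLT_sort s).pairwise

theorem sort_eq_append_of_forall_le {s : Finset ℕ} {u : ℕ} (hu : u ∈ s) (h : ∀ w ∈ s, w ≤ u) :
    s.sort (· ≤ ·) = (s.erase u).sort (· ≤ ·) ++ [u] := by
  refine sort_eq_of_pairwise (List.pairwise_append.2 ⟨pairwise_lt_sort _, by simp, ?_⟩) ?_
  · intro w hw x hx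
    rw [Finset.mem_sort, Finset.mem_erase] at hw
    rw [List.mem_singleton] at hx
    exact hx ▸ lt_of_le_of_ne (h w hw.2) hw.1
  · intro w
    rw [List.mem_append, Finset.mem_sort, Finset.mem_erase, List.mem_singleton]
    by_cases hw : w = u <;> simp [hw, hu]

namespace NCProbSpace

variable {B A : Type*} [Ring B] [Algebra ℂ B] [Ring A] [Algebra ℂ A]

/-- The argument of the block `V` at `v ∈ V`. -/
def blockArg (P : NCProbSpace B A) (m : List A → B) (a : ℕ → A) (S V : Finset ℕ) (v : ℕ) : A :=
  a v * P.incl (m (((gap S V v).sort (· ≤ ·)).map a))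

/-- The invariant of the recursion: U is the part of the block chosen so far and u its last element;
of the elements of S after u, those in g have been assigned to the gap after u and those in r are
undecided. -/
theorem sum_powerset_eq_blockSum (P : NCProbSpace B A) (f m : List A → B) (a : ℕ → A)
    (S U : Finset ℕ) (u : ℕ) (hu : u ∈ U) (hmax : ∀ w ∈ U, w ≤ u) (g r : List ℕ)
    (hgr : (S.filter (u < ·)).sort (· ≤ ·) = g ++ r) :
    ∑ W ∈ r.toFinset.powerset, f (((U ∪ W).sort (· ≤ ·)).map (P.blockArg m a S (U ∪ W))) =
      P.blockSum f m (((U.erase u).sort (· ≤ ·)).map (P.blockArg m a S U)) (a u) (g.map a)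
        (r.map a) := by
  induction r generalizing U u g with
  | nil =>
    have hg : gap S U u = S.filter (u < ·) := Finset.filter_congr fun x _ =>
      and_iff_left fun w hw h => absurd h (hmax w hw).not_gt
    rw [List.append_nil] at hgr
    simp [blockSum, sort_eq_append_of_forall_le hu hmax, blockArg, hg, hgr]
  | cons x r ih =>
    have hp := pairwise_lt_sort (S.filter (u < ·))
    have hmem : ∀ w, w ∈ S ∧ u < w ↔ w ∈ g ∨ w = x ∨ w ∈ r := fun w => by
      rw [← Finset.mem_filter, ← Finset.mem_sort (· ≤ ·), hgr]
      simp
    rw [hgr] at hp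
    obtain ⟨hpg, hpr, hgx⟩ := List.pairwise_append.1 hp
    obtain ⟨hxr, hpr⟩ := List.pairwise_cons.1 hpr
    have hux : u < x := ((hmem x).2 (Or.inr (Or.inl rfl))).2
    have hxnot : x ∉ r.toFinset := fun h => lt_irrefl x (hxr x (List.mem_toFinset.1 h))
    have hxU : x ∉ U := fun h => (hmax x h).not_gt hux
    have h₁ := ih U u hu hmax (g ++ [x]) (by rw [hgr, List.append_assoc]; rfl)
    have hmax' : ∀ w ∈ insert x U, w ≤ x := fun w hw => by
      rcases Finset.mem_insert.1 hw with rfl | hw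
      · exact le_rfl
      · exact (hmax w hw).trans hux.le
    have h₂ := ih (insert x U) x (Finset.mem_insert_self _ _) hmax' []
      (sort_eq_of_pairwise hpr fun w => by
        rw [Finset.mem_filter]
        constructor
        · rintro ⟨hw, hxw⟩
          rcases (hmem w).1 ⟨hw, hux.trans hxw⟩ with h | h | h
          · exact absurd (hgx w h x (by simp)) hxw.not_gt
          · exact absurd h hxw.ne'
          · exact h
        · exact fun hw => ⟨((hmem w).2 (Or.inr (Or.inr hw))).1, hxr w hw⟩)
    have hargs : (((insert x U).erase x).sort (· ≤ ·)).map (P.blockArg m a S (insert x U)) =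
        ((U.erase u).sort (· ≤ ·)).map (P.blockArg m a S U) ++
          [a u * P.incl (m (g.map a))] := by
      rw [Finset.erase_insert hxU, sort_eq_append_of_forall_le hu hmax, List.map_append]
      congr 1
      · refine List.map_congr_left fun v hv => ?_
        rw [Finset.mem_sort, Finset.mem_erase] at hv
        have hvu := lt_of_le_of_ne (hmax v hv.2) hv.1
        have : gap S (insert x U) v = gap S U v := Finset.filter_congr fun y _ => by
          simp only [Finset.mem_insert, forall_eq_or_imp]
          constructor
          · exact fun h => ⟨h.1, h.2.2⟩
          · exact fun h => ⟨h.1, fun _ => (h.2 u hu hvu).trans hux, h.2⟩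
        rw [blockArg, blockArg, this]
      · have : (gap S (insert x U) u).sort (· ≤ ·) = g := sort_eq_of_pairwise hpg fun w => by
          rw [mem_gap]
          simp only [Finset.mem_insert, forall_eq_or_imp]
          constructor
          · rintro ⟨hw, huw, hwx, -⟩
            rcases (hmem w).1 ⟨hw, huw⟩ with h | h | h
            · exact h
            · exact absurd h (hwx hux).ne
            · exact absurd (hxr w h) (hwx hux).not_gt
          · exact fun hw => ⟨((hmem w).2 (by simp [hw])).1, ((hmem w).2 (by simp [hw])).2,
              fun _ => hgx w hw x (by simp), fun y hy h => absurd h (hmax y hy).not_gt⟩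
        rw [List.map_singleton, blockArg, this]
    rw [hargs] at h₂
    -- Sets W without x put x into the current gap; sets with x close that gap and make x the last
    -- chosen element.
    rw [List.toFinset_cons, Finset.sum_powerset_insert hxnot, h₁, List.map_cons, blockSum,
      List.map_append, List.map_singleton]
    congr 1
    refine Eq.trans ?_ h₂
    refine Finset.sum_congr rfl fun W _ => ?_
    rw [Finset.union_insert, Finset.insert_union]

theorem nestedSum_firstBlockCumulant (P : NCProbSpace B A) (a : ℕ → A) (S : Finset ℕ) :
    P.nestedSum P.firstBlockCumulant a S = P.moment ((S.sort (· ≤ ·)).map a) := by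
  induction hS : S.card using Nat.strong_induction_on generalizing S with
  | _ N ih =>
    by_cases hne : S.Nonempty
    · have hmin : ∀ u ∈ S, S.min' hne ≤ u := fun u hu => S.min'_le u hu
      have hmS := S.min'_mem hne
      rw [nestedSum_eq_sum_block P P.isAdditive_firstBlockCumulant a hne]
      set m := S.min' hne with hm
      have hsort : (S.erase m).filter (m < ·) = S.erase m := Finset.filter_true_of_mem
        fun u hu => lt_of_le_of_ne (hmin u (Finset.mem_of_mem_erase hu)) (Finset.ne_of_mem_erase hu).symm
      have hS' : S.sort (· ≤ ·) = m :: (S.erase m).sort (· ≤ ·) := by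
        conv_lhs => rw [← Finset.insert_erase hmS]
        exact Finset.sort_insert (· ≤ ·) (fun b hb => hmin b (Finset.mem_of_mem_erase hb))
          (Finset.notMem_erase _ _)
      have h := P.sum_powerset_eq_blockSum P.firstBlockCumulant P.moment a (S.erase m) {m} m
        (Finset.mem_singleton_self _) (by simp) [] ((S.erase m).sort (· ≤ ·)) (by rw [hsort]; rfl)
      simp only [Finset.sort_toFinset, Finset.erase_singleton, Finset.sort_empty, List.map_nil] at h
      rw [hS', List.map_cons, moment_cons_eq_blockSum, ← h]
      refine Finset.sum_congr rfl fun W _ => ?_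
      rw [← Finset.insert_eq]
      congr 1
      refine List.map_congr_left fun v _ => ?_
      rw [blockArg, ih _ _ _ rfl]
      rw [← hS]
      exact (Finset.card_le_card (gap_subset _ _ _)).trans_lt (Finset.card_erase_lt_of_mem hmS)
    · rw [Finset.not_nonempty_iff_eq_empty] at hne
      subst hne
      have : noncrossingPartitions ∅ = {(⊥ : Finpartition (∅ : Finset ℕ))} := by
        ext π
        simp only [noncrossingPartitions, Finset.mem_filter, Finset.mem_univ, true_and,
          Finset.mem_singleton]
        constructor
        · exact fun _ => finpartition_ext_part fun i hi => absurd hi (Finset.notMem_empty i)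
        · rintro rfl V hV
          simp at hV
      simp [nestedSum, this, nested, moment_nil]

theorem map_getD_range {A : Type*} [Zero A] (l : List A) :
    (List.range l.length).map (fun i => l.getD i 0) = l :=
  List.ext_getElem (by simp) fun i hi hi' => by simp [hi']

theorem sum_multExt_firstBlockCumulant (P : NCProbSpace B A) (l : List A) :
    ∑ π ∈ NC l.length, P.multExt P.firstBlockCumulant l π = P.moment l := by
  have h := P.nestedSum_firstBlockCumulant (fun i => l.getD i 0) (Finset.range l.length)
  rw [Finset.sort_range, map_getD_range] at h
  exact h

/-- The summand of the one-block partition. -/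
theorem sum_multExt_one_block (P : NCProbSpace B A) (f : List A → B) (l : List A) (hl : l ≠ []) :
    ∑ π ∈ NC l.length with ¬ 1 < π.parts.card, P.multExt f l π = f l := by
  classical
  have hne : Finset.range l.length ≠ ⊥ := by simpa using hl
  have hf : (NC l.length).filter (fun π => ¬ 1 < π.parts.card) =
      {Finpartition.indiscrete hne} := by
    ext π
    simp only [Finset.mem_filter, Finset.mem_singleton]
    constructor
    · rintro ⟨-, h⟩
      have h0 : π.parts.card ≠ 0 := fun h =>
        hne (π.parts_eq_empty_iff.1 (Finset.card_eq_zero.1 h))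
      obtain ⟨V, hV⟩ := Finset.card_eq_one.1 (show π.parts.card = 1 by omega)
      have hVT := π.sup_parts
      simp only [hV, Finset.sup_singleton, id_eq] at hVT
      ext1
      rw [hV, hVT, Finpartition.indiscrete_parts]
    · rintro rfl
      have hnc : IsNoncrossing (Finpartition.indiscrete hne) :=
        fun V hV W hW _ _ _ _ _ _ _ _ _ _ _ => by
          rw [Finpartition.indiscrete_parts, Finset.mem_singleton] at hV hW
          rw [hV, hW]
      exact ⟨Finset.mem_filter.2 ⟨Finset.mem_univ _, hnc⟩, by simp⟩
  rw [hf, Finset.sum_singleton, multExt_of_card_eq_one _ _ _ _ (by simp)]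

theorem card_part_lt {T : Finset ℕ} {π : Finpartition T} (hπ : 1 < π.parts.card) (i : ℕ) :
    (π.part i).card < T.card := by
  obtain ⟨V, hV, W, hW, hVW⟩ := Finset.one_lt_card.1 hπ
  refine Finset.card_lt_card ((π.part_subset i).ssubset_of_ne fun h => ?_)
  have hall : ∀ V ∈ π.parts, V = π.part i := fun V hV => by
    obtain ⟨v, hv⟩ := π.nonempty_of_mem_parts hV
    have hvT := π.le hV hv
    have hvi : v ∈ π.part i := by rwa [h]
    rw [← π.part_eq_of_mem hV hv,
      π.part_eq_of_mem (π.part_mem.2 (π.part_nonempty.1 ⟨v, hvi⟩)) hvi]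
  exact hVW ((hall V hV).trans (hall W hW).symm)

/-- Both families satisfy the moment-cumulant formula, which determines the one-block summand from
cumulants of lower order. -/
theorem cumulant_eq_firstBlockCumulant (P : NCProbSpace B A) (l : List A) :
    P.cumulant l = P.firstBlockCumulant l := by
  induction hn : l.length using Nat.strong_induction_on generalizing l with
  | _ n ih =>
    have hsum := P.sum_multExt_firstBlockCumulant l
    have hlt : ∑ π ∈ NC l.length with 1 < π.parts.card, P.multExt
          (fun l' => if l'.length < l.length then P.cumulant l' else 0) l π =
        ∑ π ∈ NC l.length with 1 < π.parts.card, P.multExt P.firstBlockCumulant l π := by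
      refine Finset.sum_congr rfl fun π hπ => ?_
      refine P.nested_congr π _ l.length (fun l' h => ?_) (fun i => ?_) _
      · rw [if_pos h, ih _ (hn ▸ h) l' rfl]
      · simpa using card_part_lt (Finset.mem_filter.1 hπ).2 i
    rw [cumulant, hlt]
    -- The empty word has no one-block partition; there both sides equal φ(1) = 1.
    by_cases hl : l = []
    · subst hl
      rw [Finset.sum_eq_zero fun π hπ => ?_]
      · simp [firstBlockCumulant, P.φ_one]
      · have h₁ := (Finset.mem_filter.1 hπ).2
        have h₂ := π.card_parts_le_card
        exact absurd (h₁.trans_le h₂) (by simp)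
    · rw [← Finset.sum_filter_add_sum_filter_not _ (fun π => 1 < π.parts.card),
        P.sum_multExt_one_block _ l hl] at hsum
      exact sub_eq_of_eq_add' hsum.symm

end NCProbSpace

/-! ### Freeness and centered alternating words -/

namespace NCProbSpace

variable {B A : Type*} [Ring B] [Algebra ℂ B] [Ring A] [Algebra ℂ A]

section Free

variable {P : NCProbSpace B A} {ι : Type*} {𝒜 : ι → Subalgebra ℂ A}

theorem FreeSubalgebras.firstBlockCumulant_eq_zero (h : P.FreeSubalgebras 𝒜) {l : List (ι × A)}
    (hl : ∀ x ∈ l, x.2 ∈ 𝒜 x.1) {x y : ι × A} (hx : x ∈ l) (hy : y ∈ l) (hxy : x.1 ≠ y.1) :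
    P.firstBlockCumulant (l.map Prod.snd) = 0 := by
  obtain ⟨j, hj, rfl⟩ := List.getElem_of_mem hx
  obtain ⟨k, hk, rfl⟩ := List.getElem_of_mem hy
  have h0 := h l.length (fun j => l[j].1) (fun j => l[j].2) (fun j => hl _ (List.getElem_mem _))
    ⟨⟨j, hj⟩, ⟨k, hk⟩, hxy⟩
  rw [cumulant_eq_firstBlockCumulant] at h0
  rw [← h0]
  congr 1
  exact List.ext_getElem (by simp) fun i hi hi' => by simp

/-- Once two chosen letters come from different subalgebras, every completion of the block is mixed.
The inserted gap moments lie in B and keep each argument in its subalgebra. -/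
theorem FreeSubalgebras.blockSum_eq_zero (h : P.FreeSubalgebras 𝒜)
    (hB : ∀ i b, P.incl b ∈ 𝒜 i) (m : List A → B) {acc : List (ι × A)}
    (hacc : ∀ x ∈ acc, x.2 ∈ 𝒜 x.1) {i : ι} {a : A} (ha : a ∈ 𝒜 i) (g : List A) {rest : List A}
    (hrest : ∀ x ∈ rest, ∃ j, x ∈ 𝒜 j)
    (hmixed : ∃ x ∈ acc, ∃ j ∈ i :: acc.map Prod.fst, x.1 ≠ j) :
    P.blockSum P.firstBlockCumulant m (acc.map Prod.snd) a g rest = 0 := by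
  have hmem : ∀ (acc : List (ι × A)) (i : ι) (a : A) (b : B), (∀ x ∈ acc, x.2 ∈ 𝒜 x.1) →
      a ∈ 𝒜 i → ∀ x ∈ acc ++ [(i, a * P.incl b)], x.2 ∈ 𝒜 x.1 := by
    intro acc i a b hacc ha x hx
    rcases List.mem_append.1 hx with hx | hx
    · exact hacc x hx
    · rw [List.mem_singleton.1 hx]
      exact mul_mem ha (hB i b)
  induction rest generalizing acc i a g with
  | nil =>
    obtain ⟨x, hx, j, hj, hxj⟩ := hmixed
    have hj' : j ∈ (acc ++ [(i, a * P.incl (m g))]).map Prod.fst := by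
      simpa [or_comm, eq_comm] using hj
    obtain ⟨y, hy, rfl⟩ := List.mem_map.1 hj'
    simpa [blockSum] using h.firstBlockCumulant_eq_zero (hmem acc i a (m g) hacc ha)
      (List.mem_append_left _ hx) hy hxj
  | cons y rest ih =>
    obtain ⟨k, hk⟩ := hrest y (List.mem_cons_self ..)
    have hrest' := fun x hx => hrest x (List.mem_cons_of_mem _ hx)
    have h₂ := ih (hmem acc i a (m g) hacc ha) hk [] hrest' (by
      obtain ⟨x, hx, j, hj, hxj⟩ := hmixed
      refine ⟨x, List.mem_append_left _ hx, j, List.mem_cons_of_mem _ ?_, hxj⟩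
      simpa [or_comm, eq_comm] using hj)
    rw [List.map_append, List.map_singleton] at h₂
    rw [blockSum, ih hacc ha _ hrest' hmixed, h₂, add_zero]

theorem IsAdditive.blockSum_eq_zero (P : NCProbSpace B A) {f : List A → B} (hf : IsAdditive f)
    (m : List A → B) {acc : List A} (hacc : 0 ∈ acc) (a : A) (g rest : List A) :
    P.blockSum f m acc a g rest = 0 := by
  induction rest generalizing acc a g with
  | nil => exact hf.eq_zero (List.mem_append_left _ hacc)
  | cons x rest ih => rw [blockSum, ih hacc, ih (List.mem_append_left _ hacc), add_zero]

/-- Words of centered elements of the subalgebras `𝒜 i`, with neighbouring letters taken from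
different subalgebras. -/
structure IsCenteredAlternating (P : NCProbSpace B A) (𝒜 : ι → Subalgebra ℂ A)
    (l : List (ι × A)) : Prop where
  isChain : (l.map Prod.fst).IsChain (· ≠ ·)
  mem : ∀ x ∈ l, x.2 ∈ 𝒜 x.1
  φ_eq_zero : ∀ x ∈ l, P.φ x.2 = 0

theorem IsCenteredAlternating.left_of_append {l l' : List (ι × A)}
    (h : P.IsCenteredAlternating 𝒜 (l ++ l')) : P.IsCenteredAlternating 𝒜 l where
  isChain := by
    have := h.isChain
    rw [List.map_append] at this
    exact this.left_of_append
  mem x hx := h.mem x (List.mem_append_left _ hx)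
  φ_eq_zero x hx := h.φ_eq_zero x (List.mem_append_left _ hx)

theorem IsCenteredAlternating.right_of_append {l l' : List (ι × A)}
    (h : P.IsCenteredAlternating 𝒜 (l ++ l')) : P.IsCenteredAlternating 𝒜 l' where
  isChain := by
    have := h.isChain
    rw [List.map_append] at this
    exact this.right_of_append
  mem x hx := h.mem x (List.mem_append_right _ hx)
  φ_eq_zero x hx := h.φ_eq_zero x (List.mem_append_right _ hx)

/-- Freeness in terms of moments. -/
theorem FreeSubalgebras.moment_eq_zero (h : P.FreeSubalgebras 𝒜) (hB : ∀ i b, P.incl b ∈ 𝒜 i)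
    {l : List (ι × A)} (hl : P.IsCenteredAlternating 𝒜 l) (hne : l ≠ []) :
    P.moment (l.map Prod.snd) = 0 := by
  induction hn : l.length using Nat.strong_induction_on generalizing l with
  | _ n ih =>
    -- If the first gap is nonempty, it is a shorter centered alternating word when it closes; its
    -- moment vanishes by induction and makes one argument zero.
    have inner : ∀ (rest : List (ι × A)) (a : A) (g : List (ι × A)), g ≠ [] →
        P.IsCenteredAlternating 𝒜 (g ++ rest) → (g ++ rest).length < n →
        P.blockSum P.firstBlockCumulant P.moment [] a (g.map Prod.snd) (rest.map Prod.snd) = 0 := by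
      intro rest
      induction rest with
      | nil =>
        intro a g hg hc hlt
        rw [List.append_nil] at hc hlt
        refine P.isAdditive_firstBlockCumulant.eq_zero ?_
        simp [ih _ hlt hc hg rfl]
      | cons x rest ihr =>
        intro a g hg hc hlt
        have h₁ := ihr a (g ++ [x]) (by simp) (by simpa using hc) (by simpa using hlt)
        have h₂ : P.moment (g.map Prod.snd) = 0 := ih _ (by simp at hlt; omega)
          hc.left_of_append hg rfl
        rw [List.map_append, List.map_singleton] at h₁
        rw [List.map_cons, blockSum, h₁, zero_add]
        refine P.isAdditive_firstBlockCumulant.blockSum_eq_zero P _ ?_ _ _ _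
        simp [h₂]
    -- For at least two letters, the block of x either skips y, so that `inner` applies, or contains
    -- y and is mixed.
    match l, hne with
    | [x], _ => simpa [moment] using hl.φ_eq_zero x (by simp)
    | x :: y :: l, _ =>
      have hxy : x.1 ≠ y.1 := by
        have := hl.isChain
        simp only [List.map_cons, List.isChain_cons_cons] at this
        exact this.1
      have h₁ := inner l x.2 [y] (by simp) (hl.right_of_append (l := [x])) (by simp at hn ⊢; omega)
      have h₂ := h.blockSum_eq_zero hB P.moment
        (acc := [(x.1, x.2 * P.incl (P.moment []))]) (a := y.2) (i := y.1)
        (by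
          intro z hz
          rw [List.mem_singleton.1 hz]
          exact mul_mem (hl.mem x (by simp)) (hB _ _))
        (hl.mem y (by simp)) [] (rest := l.map Prod.snd)
        (by
          intro z hz
          obtain ⟨u, hu, rfl⟩ := List.mem_map.1 hz
          exact ⟨u.1, hl.mem u (by simp [hu])⟩)
        ⟨_, List.mem_singleton_self _, y.1, by simp, hxy⟩
      rw [List.map_cons, List.map_cons, moment_cons_eq_blockSum, blockSum]
      exact (congrArg₂ (· + ·) h₁ h₂).trans (add_zero 0)

/-- The additive span of the products `b a₁ ⋯ a_n` with `b ∈ B` and `a₁, …, a_n` centered and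
alternating. -/
def centeredSpan (P : NCProbSpace B A) (𝒜 : ι → Subalgebra ℂ A) : AddSubgroup A :=
  AddSubgroup.closure {w | ∃ (b : B) (l : List (ι × A)), P.IsCenteredAlternating 𝒜 l ∧
    w = P.incl b * (l.map Prod.snd).prod}

theorem one_mem_centeredSpan (P : NCProbSpace B A) (𝒜 : ι → Subalgebra ℂ A) :
    1 ∈ P.centeredSpan 𝒜 :=
  AddSubgroup.subset_closure ⟨1, [], ⟨by simp, by simp, by simp⟩, by simp⟩

theorem φ_sub_incl (P : NCProbSpace B A) (a : A) : P.φ (a - P.incl (P.φ a)) = 0 := by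
  rw [map_sub, P.φ_incl, sub_self]

theorem mul_prod_mem_centeredSpan (hB : ∀ i b, P.incl b ∈ 𝒜 i) {i : ι} {a : A} (ha : a ∈ 𝒜 i)
    {l : List (ι × A)} (hl : P.IsCenteredAlternating 𝒜 l)
    (hi : (i :: l.map Prod.fst).IsChain (· ≠ ·)) :
    a * (l.map Prod.snd).prod ∈ P.centeredSpan 𝒜 := by
  have h : a * (l.map Prod.snd).prod =
      P.incl 1 * (((i, a - P.incl (P.φ a)) :: l).map Prod.snd).prod +
        P.incl (P.φ a) * (l.map Prod.snd).prod := by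
    simp [sub_mul]
  rw [h]
  refine add_mem (AddSubgroup.subset_closure ⟨1, (i, a - P.incl (P.φ a)) :: l, ⟨hi, ?_, ?_⟩, rfl⟩)
    (AddSubgroup.subset_closure ⟨_, _, hl, rfl⟩)
  · intro x hx
    rcases List.mem_cons.1 hx with rfl | hx
    · exact sub_mem ha (hB _ _)
    · exact hl.mem x hx
  · intro x hx
    rcases List.mem_cons.1 hx with rfl | hx
    · exact P.φ_sub_incl a
    · exact hl.φ_eq_zero x hx

/-- The new factor is merged with the first letter if both lie in the same subalgebra, and is then
split into its centered part and its expectation. Hence the span contains all products of elements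
of the 𝒜 i. -/
theorem mul_mem_centeredSpan (hB : ∀ i b, P.incl b ∈ 𝒜 i) {i : ι} {a w : A} (ha : a ∈ 𝒜 i)
    (hw : w ∈ P.centeredSpan 𝒜) : a * w ∈ P.centeredSpan 𝒜 := by
  induction hw using AddSubgroup.closure_induction with
  | zero => rw [mul_zero]; exact zero_mem _
  | add x y _ _ hx hy => rw [mul_add]; exact add_mem hx hy
  | neg x _ hx => rw [mul_neg]; exact neg_mem hx
  | mem w hw =>
    obtain ⟨b, l, hl, rfl⟩ := hw
    have hab := mul_mem ha (hB i b)
    rw [← mul_assoc]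
    cases l with
    | nil => exact mul_prod_mem_centeredSpan hB hab hl (by simp)
    | cons x l =>
      by_cases hx : x.1 = i
      · rw [List.map_cons, List.prod_cons, ← mul_assoc]
        exact mul_prod_mem_centeredSpan hB (mul_mem hab (hx ▸ hl.mem x (by simp)))
          (hl.right_of_append (l := [x])) (hx ▸ hl.isChain)
      · refine mul_prod_mem_centeredSpan hB hab hl ?_
        rw [List.map_cons, List.isChain_cons_cons]
        exact ⟨fun h => hx h.symm, hl.isChain⟩

/-- Either p is merged into the last letter or it becomes a new letter. After centering, the word is
alternating, and the correction term is the moment of a nonempty centered word times an element of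
B. The excluded word is a single letter z of 𝒜 i₀, for which φ(z p) need not vanish. -/
theorem FreeSubalgebras.φ_prod_mul_eq_zero (h : P.FreeSubalgebras 𝒜)
    (hB : ∀ i b, P.incl b ∈ 𝒜 i) {i₀ : ι} {p : A} (hp : p ∈ 𝒜 i₀) {l : List (ι × A)}
    (hl : P.IsCenteredAlternating 𝒜 l) (hne : l ≠ []) (hl₀ : ∀ x, l = [x] → x.1 ≠ i₀) :
    P.φ ((l.map Prod.snd).prod * p) = 0 := by
  obtain ⟨l, z, rfl⟩ := (List.eq_nil_or_concat' l).resolve_left hne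
  have hz := hl.mem z (by simp)
  have hmom : ∀ {l : List (ι × A)}, P.IsCenteredAlternating 𝒜 l → l ≠ [] →
      P.φ (l.map Prod.snd).prod = 0 := fun hl hne => h.moment_eq_zero hB hl hne
  by_cases hi : z.1 = i₀
  · have hzp : z.2 * p ∈ 𝒜 z.1 := mul_mem hz (hi ▸ hp)
    have hc : P.IsCenteredAlternating 𝒜 (l ++ [(z.1, z.2 * p - P.incl (P.φ (z.2 * p)))]) := by
      refine ⟨by simpa using hl.isChain, fun x hx => ?_, fun x hx => ?_⟩
      · rcases List.mem_append.1 hx with hx | hx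
        · exact hl.mem x (by simp [hx])
        · rw [List.mem_singleton.1 hx]
          exact sub_mem hzp (hB _ _)
      · rcases List.mem_append.1 hx with hx | hx
        · exact hl.φ_eq_zero x (by simp [hx])
        · rw [List.mem_singleton.1 hx]
          exact P.φ_sub_incl _
    have h₁ := hmom hc (by simp)
    have h₂ := hmom hl.left_of_append (fun h0 => hl₀ z (by simp [h0]) hi)
    simp only [List.map_append, List.map_singleton, List.prod_append, List.prod_singleton,
      mul_sub, map_sub, φ_mul_incl, h₂, zero_mul, sub_zero] at h₁
    simpa [mul_assoc] using h₁
  · have hc : P.IsCenteredAlternating 𝒜 ((l ++ [z]) ++ [(i₀, p - P.incl (P.φ p))]) := by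
      refine ⟨?_, fun x hx => ?_, fun x hx => ?_⟩
      · have := hl.isChain
        simp only [List.map_append, List.map_cons, List.map_nil, List.append_assoc,
          List.cons_append, List.nil_append] at this ⊢
        rw [List.isChain_append_cons_cons]
        exact ⟨this, hi, by simp⟩
      · rcases List.mem_append.1 hx with hx | hx
        · exact hl.mem x hx
        · rw [List.mem_singleton.1 hx]
          exact sub_mem hp (hB _ _)
      · rcases List.mem_append.1 hx with hx | hx
        · exact hl.φ_eq_zero x hx
        · rw [List.mem_singleton.1 hx]
          exact P.φ_sub_incl _
    have h₁ := hmom hc (by simp)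
    have h₂ := hmom hl (by simp)
    rw [List.map_append, List.prod_append, List.map_singleton, List.prod_singleton, mul_sub,
      map_sub, φ_mul_incl, h₂, zero_mul, sub_zero] at h₁
    exact h₁

/-- This replaces traciality. If a word is empty or a single letter of 𝒜 i₀, the product itself is
zero by `hqp`. Otherwise q is absorbed into a first letter from 𝒜 i₀, letters from elsewhere remain,
and centering that first letter reduces to `φ_prod_mul_eq_zero`. -/
theorem FreeSubalgebras.φ_mul_mul_eq_zero (h : P.FreeSubalgebras 𝒜)
    (hB : ∀ i b, P.incl b ∈ 𝒜 i) {i₀ : ι} {p q : A} (hp : p ∈ 𝒜 i₀) (hq : q ∈ 𝒜 i₀)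
    (hqB : ∀ b, Commute q (P.incl b)) (hqp : ∀ a ∈ 𝒜 i₀, q * a * p = 0) {w : A}
    (hw : w ∈ P.centeredSpan 𝒜) : P.φ (q * w * p) = 0 := by
  induction hw using AddSubgroup.closure_induction with
  | zero => simp
  | add x y _ _ hx hy => rw [mul_add, add_mul, map_add, hx, hy, add_zero]
  | neg x _ hx => rw [mul_neg, neg_mul, map_neg, hx, neg_zero]
  | mem w hw =>
    obtain ⟨b, l, hl, rfl⟩ := hw
    rw [← mul_assoc, (hqB b).eq, mul_assoc, mul_assoc, φ_incl_mul, ← mul_assoc]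
    -- replacing the first letter of a word by an element of `𝒜 i₀`
    have key : ∀ a ∈ 𝒜 i₀, ∀ l : List (ι × A), P.IsCenteredAlternating 𝒜 l → l ≠ [] →
        (i₀ :: l.map Prod.fst).IsChain (· ≠ ·) → P.φ (a * (l.map Prod.snd).prod * p) = 0 := by
      intro a ha l hl hne hchain
      have hc : P.IsCenteredAlternating 𝒜 ((i₀, a - P.incl (P.φ a)) :: l) := by
        refine ⟨hchain, fun x hx => ?_, fun x hx => ?_⟩
        · rcases List.mem_cons.1 hx with rfl | hx
          · exact sub_mem ha (hB _ _)
          · exact hl.mem x hx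
        · rcases List.mem_cons.1 hx with rfl | hx
          · exact P.φ_sub_incl a
          · exact hl.φ_eq_zero x hx
      have h₁ := h.φ_prod_mul_eq_zero hB hp hc (by simp) fun x hx => absurd hx (by simp [hne])
      have h₂ := h.φ_prod_mul_eq_zero hB hp hl hne fun x hx => by
        rw [hx, List.map_singleton, List.isChain_cons_cons] at hchain
        exact hchain.1.symm
      rw [List.map_cons, List.prod_cons, sub_mul, sub_mul, map_sub, mul_assoc (P.incl _),
        φ_incl_mul, h₂, mul_zero, sub_zero] at h₁
      exact h₁
    have hzero : P.φ (q * (l.map Prod.snd).prod * p) = 0 := by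
      cases l with
      | nil => simpa using congrArg P.φ (hqp 1 (one_mem _))
      | cons x l =>
        by_cases hx : x.1 = i₀
        · have hxm : x.2 ∈ 𝒜 i₀ := hx ▸ hl.mem x (by simp)
          by_cases hne : l = []
          · simp [hne, hqp _ hxm]
          · rw [List.map_cons, List.prod_cons, ← mul_assoc]
            exact key _ (mul_mem hq hxm) l (hl.right_of_append (l := [x])) hne (hx ▸ hl.isChain)
        · refine key q hq _ hl (by simp) ?_
          rw [List.map_cons, List.isChain_cons_cons]
          exact ⟨fun h => hx h.symm, hl.isChain⟩
    rw [hzero, mul_zero]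

end Free

/-! ### Words interleaved with the idempotent -/

/-- The word `y₁, p, y₂, p, …, y_n, p`. -/
def interleave {A : Type*} (p : A) (l : List A) : List A := l.flatMap fun y => [y, p]

section Interleave

variable {P : NCProbSpace B A} {ι : Type*} {𝒜 : ι → Subalgebra ℂ A} {i₀ i₁ : ι} {p : A}

theorem prod_interleave_mul {A : Type*} [Ring A] {p : A} (hp : IsIdempotentElem p) {l : List A} (hl : l ≠ []) :
    (interleave p l).prod * p = (interleave p l).prod := by
  obtain ⟨l, z, rfl⟩ := (List.eq_nil_or_concat' l).resolve_left hl
  simp [interleave, mul_assoc, hp.eq]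

theorem FreeSubalgebras.moment_cons_interleave (h : P.FreeSubalgebras 𝒜)
    (hB : ∀ i b, P.incl b ∈ 𝒜 i) (hp : IsIdempotentElem p) (hpB : ∀ b, Commute p (P.incl b))
    (hpm : p ∈ 𝒜 i₀) (hcomm : ∀ a ∈ 𝒜 i₀, Commute p a) {l : List A} (hl : ∀ y ∈ l, y ∈ 𝒜 i₁)
    (hne : l ≠ []) : P.moment (p :: interleave p l) = P.moment (interleave p l) := by
  have hw : (interleave p l).prod ∈ P.centeredSpan 𝒜 := by
    clear hne
    induction l with
    | nil => exact P.one_mem_centeredSpan 𝒜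
    | cons y l ih =>
      have : (interleave p (y :: l)).prod = y * (p * (interleave p l).prod) := by
        simp [interleave]
      rw [this]
      exact mul_mem_centeredSpan hB (hl y (by simp)) (mul_mem_centeredSpan hB hpm
        (ih fun x hx => hl x (by simp [hx])))
  -- For a in 𝒜 i₀, (1 - p) a p = (1 - p) p a = 0, since p commutes with a.
  have h0 := h.φ_mul_mul_eq_zero hB (q := 1 - p) hpm (sub_mem (one_mem _) hpm)
    (fun b => (Commute.one_left _).sub_left (hpB b))
    (fun a ha => by rw [mul_assoc, ← (hcomm a ha).eq, ← mul_assoc, sub_mul, one_mul, hp.eq,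
      sub_self, zero_mul]) hw
  rw [mul_assoc, prod_interleave_mul hp hne, sub_mul, one_mul, map_sub, sub_eq_zero] at h0
  rw [moment, moment, List.prod_cons, h0]

/-- A block that starts with a letter of 𝒜 i₁ and also takes some p is mixed, so only the y's can be
chosen. Each gap then begins and ends with p; between neighbouring y's it is the single letter p. -/
theorem FreeSubalgebras.blockSum_interleave (h : P.FreeSubalgebras 𝒜)
    (hB : ∀ i b, P.incl b ∈ 𝒜 i) (hi : i₁ ≠ i₀) (hpm : p ∈ 𝒜 i₀) {acc : List A}
    (hacc : ∀ y ∈ acc, y ∈ 𝒜 i₁) {a : A} (ha : a ∈ 𝒜 i₁) (g : List A) {l : List A}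
    (hl : ∀ y ∈ l, y ∈ 𝒜 i₁) :
    P.blockSum P.firstBlockCumulant P.moment acc a (p :: interleave p g) (interleave p l) =
      P.blockSum P.firstBlockCumulant (fun g => P.moment (p :: interleave p g)) acc a g l := by
  have hrest : ∀ l : List A, (∀ y ∈ l, y ∈ 𝒜 i₁) → ∀ y ∈ interleave p l, ∃ j, y ∈ 𝒜 j := by
    intro l hl y hy
    obtain ⟨x, hx, hy⟩ := List.mem_flatMap.1 hy
    rcases List.mem_cons.1 hy with rfl | hy
    · exact ⟨i₁, hl _ hx⟩
    · rw [List.mem_singleton.1 hy]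
      exact ⟨i₀, hpm⟩
  have hmixed : ∀ (acc g l : List A), acc ≠ [] → (∀ y ∈ acc, y ∈ 𝒜 i₁) → (∀ y ∈ l, y ∈ 𝒜 i₁) →
      P.blockSum P.firstBlockCumulant P.moment acc p g (interleave p l) = 0 := by
    intro acc g l hne hacc hl
    obtain ⟨z, hz⟩ := List.exists_mem_of_ne_nil _ hne
    have := h.blockSum_eq_zero hB P.moment (acc := acc.map fun y => (i₁, y)) (by simpa using hacc)
      hpm g (hrest l hl) ⟨(i₁, z), by simpa using hz, i₀, by simp, hi⟩
    simpa [Function.comp_def] using this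
  induction l generalizing acc a g with
  | nil => rfl
  | cons x l ih =>
    have hx := hl x (by simp)
    have hl' : ∀ y ∈ l, y ∈ 𝒜 i₁ := fun y hy => hl y (by simp [hy])
    have hacc' : ∀ b : B, ∀ y ∈ acc ++ [a * P.incl b], y ∈ 𝒜 i₁ := by
      intro b y hy
      rcases List.mem_append.1 hy with hy | hy
      · exact hacc y hy
      · rw [List.mem_singleton.1 hy]
        exact mul_mem ha (hB _ _)
    have hacc'' : ∀ b b' : B, ∀ y ∈ acc ++ [a * P.incl b] ++ [x * P.incl b'], y ∈ 𝒜 i₁ := by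
      intro b b' y hy
      rcases List.mem_append.1 hy with hy | hy
      · exact hacc' b y hy
      · rw [List.mem_singleton.1 hy]
        exact mul_mem hx (hB _ _)
    have hcons : interleave p (x :: l) = x :: p :: interleave p l := rfl
    have h₁ := ih hacc ha (g ++ [x]) hl'
    have h₂ := ih (hacc' (P.moment (p :: interleave p g))) hx [] hl'
    have happ : p :: interleave p (g ++ [x]) = p :: interleave p g ++ [x] ++ [p] := by
      simp [interleave]
    rw [hcons, blockSum, blockSum, blockSum, hmixed _ _ _ (by simp) (hacc' _) hl',
      hmixed _ _ _ (by simp) (hacc'' _ _) hl', add_zero, add_zero, blockSum, ← h₁, ← h₂, happ]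
    rfl

theorem leftTuple_map_const (P : NCProbSpace B A) (b : B) (l : List A) :
    P.leftTuple b (l.map fun y => (y, b)) = l.map fun y => P.incl b * y := by
  induction l with
  | nil => rfl
  | cons y l ih => simp [leftTuple, ih]

theorem lastCoeff_map_const {B A : Type*} (b : B) (l : List A) :
    lastCoeff b (l.map fun y => (y, b)) = b := by
  induction l with
  | nil => rfl
  | cons y l ih => simpa [lastCoeff] using ih

/-- Balancedness moves each b into the following argument; the last b comes out on the right. -/
theorem firstBlockCumulant_map_mul_incl (P : NCProbSpace B A) (b : B) {l : List A} (hl : l ≠ []) :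
    P.firstBlockCumulant (l.map fun y => y * P.incl b) =
      P.firstBlockCumulant (P.symmTuple b l) * b := by
  have h := P.isBalanced_firstBlockCumulant (l.map fun y => (y, b))
  obtain ⟨y, l, rfl⟩ := List.exists_cons_of_ne_nil hl
  simp only [rightTuple, List.map_cons, List.map_map, leftTuple, lastCoeff, leftTuple_map_const,
    lastCoeff_map_const, map_one, one_mul] at h
  exact h

theorem blockSum_mul_incl (P : NCProbSpace B A) {f f' m m' : List A → B} {b : B}
    (hm : ∀ g, m g = m' g * b)
    (hf : ∀ l ≠ [], f (l.map fun y => y * P.incl b) = f' l * b) (acc : List A) (a : A)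
    (g rest : List A) :
    P.blockSum f m (acc.map fun y => y * P.incl b) a g rest =
      P.blockSum f' m' acc a g rest * b := by
  induction rest generalizing acc a g with
  | nil =>
    rw [blockSum, blockSum, ← hf _ (by simp), hm]
    simp [mul_assoc]
  | cons x rest ih =>
    have h := ih (acc ++ [a * P.incl (m' g)]) x []
    rw [blockSum, blockSum, add_mul, ← h, ih, hm]
    simp [mul_assoc]

/-- Right B-linearity of κ is enough: the letters of a block are only multiplied by elements of B,
and those of a gap are only passed to m. Thus κ may be the compression, which is not multiplicative.
-/
theorem blockSum_map {A' : Type*} [Ring A'] [Algebra ℂ A'] (P : NCProbSpace B A)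
    (P' : NCProbSpace B A') (κ : A → A') (hκ : ∀ a b, κ (a * P.incl b) = κ a * P'.incl b)
    (f m : List A' → B) (acc : List A) (a : A) (g rest : List A) :
    P'.blockSum f m (acc.map κ) (κ a) (g.map κ) (rest.map κ) =
      P.blockSum (fun l => f (l.map κ)) (fun l => m (l.map κ)) acc a g rest := by
  induction rest generalizing acc a g with
  | nil => simp [blockSum, hκ]
  | cons x rest ih => simp [blockSum, hκ, ← ih]

theorem blockSum_congr_of_mem (P : NCProbSpace B A) {f f' : List A → B} (m : List A → B)
    {S : Set A} (hS : ∀ a ∈ S, ∀ b, a * P.incl b ∈ S)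
    (hf : ∀ l : List A, (∀ y ∈ l, y ∈ S) → f l = f' l)
    {acc : List A} (hacc : ∀ y ∈ acc, y ∈ S) {a : A} (ha : a ∈ S) (g : List A) {rest : List A}
    (hrest : ∀ y ∈ rest, y ∈ S) :
    P.blockSum f m acc a g rest = P.blockSum f' m acc a g rest := by
  have hacc' : ∀ y ∈ acc ++ [a * P.incl (m g)], y ∈ S := by
    intro y hy
    rcases List.mem_append.1 hy with hy | hy
    · exact hacc y hy
    · rw [List.mem_singleton.1 hy]
      exact hS a ha _
  induction rest generalizing acc a g with
  | nil => exact hf _ hacc'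
  | cons x rest ih =>
    have hx := hrest x (by simp)
    have hrest' : ∀ y ∈ rest, y ∈ S := fun y hy => hrest y (by simp [hy])
    have hacc₁ : ∀ y ∈ acc ++ [a * P.incl (m (g ++ [x]))], y ∈ S := by
      intro y hy
      rcases List.mem_append.1 hy with hy | hy
      · exact hacc y hy
      · rw [List.mem_singleton.1 hy]
        exact hS a ha _
    have hacc₂ : ∀ y ∈ acc ++ [a * P.incl (m g)] ++ [x * P.incl (m [])], y ∈ S := by
      intro y hy
      rcases List.mem_append.1 hy with hy | hy
      · exact hacc' y hy
      · rw [List.mem_singleton.1 hy]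
        exact hS x hx _
    rw [blockSum, blockSum, ih hacc ha _ hrest' hacc₁, ih hacc' hx _ hrest' hacc₂]

/-- A functional is determined by its first-block sums. -/
theorem eq_of_blockSum_eq (P : NCProbSpace B A) {f f' m : List A → B} (hm : m [] = 1)
    {S : Set A} (hS : ∀ a ∈ S, ∀ b, a * P.incl b ∈ S) (hnil : f [] = f' [])
    (h : ∀ a ∈ S, ∀ l : List A, (∀ y ∈ l, y ∈ S) →
      P.blockSum f m [] a [] l = P.blockSum f' m [] a [] l)
    {l : List A} (hl : ∀ y ∈ l, y ∈ S) : f l = f' l := by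
  induction hn : l.length using Nat.strong_induction_on generalizing l with
  | _ n ih =>
    cases l with
    | nil => exact hnil
    | cons a l =>
      have ha := hl a (by simp)
      have hl' : ∀ y ∈ l, y ∈ S := fun y hy => hl y (by simp [hy])
      have h0 := h a ha l hl'
      -- The full block isolates the value at a :: l. The remaining terms involve shorter lists,
      -- whose entries stay in S because S is stable under right multiplication by B.
      rw [P.blockSum_eq_add f m hm, P.blockSum_eq_add f' m hm] at h0
      rw [P.blockSum_congr_of_mem m hS (f' := fun l' =>
        if l'.length < ([] : List A).length + 1 + l.length then f' l' else 0)
        (fun l' hl' => ?_) (by simp) ha [] hl'] at h0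
      · exact add_left_cancel h0
      · split_ifs with hlt
        · exact ih l'.length (by simp at hlt hn; omega) hl' rfl
        · rfl

end Interleave

/-! ### The compressed space -/

section Compress

variable (P : NCProbSpace B A) {p : A} (hp : IsIdempotentElem p)
  (hpB : ∀ b, Commute p (P.incl b)) (b₀ : Bˣ) (hb₀ : P.φ p = b₀)

theorem compressElem_mul_incl (a : A) (b : B) :
    compressElem hp (a * P.incl b) = compressElem hp a * (P.compress hp hpB b₀ hb₀).incl b := by
  refine Subtype.ext ?_
  change p * (a * P.incl b) * p = p * a * p * (P.incl b * p)
  rw [← (hpB b).eq, mul_assoc (p * a) p, ← mul_assoc p p, hp.eq, (hpB b).eq]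
  simp only [mul_assoc]

theorem prod_map_compressElem {A : Type*} [Ring A] {p : A} (hp : IsIdempotentElem p)
    (l : List A) :
    ((l.map (compressElem hp)).prod).1 = (p :: interleave p l).prod := by
  induction l with
  | nil => exact (mul_one p).symm
  | cons y l ih =>
    rw [List.map_cons, List.prod_cons]
    change p * y * p * ((l.map (compressElem hp)).prod).1 = _
    rw [ih]
    simp only [interleave, List.flatMap_cons, List.cons_append, List.nil_append, List.prod_cons]
    rw [mul_assoc (p * y), ← mul_assoc p p, hp.eq, mul_assoc]

theorem moment_cons_interleave (l : List A) :
    P.moment (p :: interleave p l) =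
      (P.compress hp hpB b₀ hb₀).moment (l.map (compressElem hp)) * b₀ := by
  change _ = ↑b₀⁻¹ * P.φ ((l.map (compressElem hp)).prod).1 * b₀
  rw [prod_map_compressElem, mul_assoc, ← hb₀, ← P.φ_central hpB, hb₀, Units.inv_mul_cancel_left]
  rfl

/-- By `eq_of_blockSum_eq` it suffices that both sides have the same first-block sums against the
compressed moments. Both sums, multiplied by b₀, equal the moment of y₁ p y₂ p ⋯ yₙ p. -/
theorem firstBlockCumulant_compress {ι : Type*} {𝒜 : ι → Subalgebra ℂ A}
    (h : P.FreeSubalgebras 𝒜) (hB : ∀ i b, P.incl b ∈ 𝒜 i) {i₀ i₁ : ι} (hi : i₁ ≠ i₀)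
    (hpm : p ∈ 𝒜 i₀) (hcomm : ∀ a ∈ 𝒜 i₀, Commute p a) {l : List A} (hl : ∀ y ∈ l, y ∈ 𝒜 i₁) :
    (P.compress hp hpB b₀ hb₀).firstBlockCumulant (l.map (compressElem hp)) =
      P.firstBlockCumulant (P.symmTuple b₀ l) := by
  set Q := P.compress hp hpB b₀ hb₀ with hQ
  refine P.eq_of_blockSum_eq (f := fun l => Q.firstBlockCumulant (l.map (compressElem hp)))
    (f' := fun l => P.firstBlockCumulant (P.symmTuple b₀ l))
    (m := fun l => Q.moment (l.map (compressElem hp))) Q.moment_nil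
    (S := 𝒜 i₁) (fun a ha b => mul_mem ha (hB _ _)) (by simp [symmTuple, firstBlockCumulant])
    (fun a ha l hl => ?_) hl
  have h₁ := P.blockSum_map Q (compressElem hp) (P.compressElem_mul_incl hp hpB b₀ hb₀)
    Q.firstBlockCumulant Q.moment [] a [] l
  rw [← h₁]
  have h₂ : P.moment (a :: p :: interleave p l) =
      P.blockSum (fun l => P.firstBlockCumulant (P.symmTuple b₀ l))
        (fun l => Q.moment (l.map (compressElem hp))) [] a [] l * b₀ := by
    -- The p directly after the first letter cannot belong to its block.
    have hz : P.blockSum P.firstBlockCumulant P.moment [a * P.incl (P.moment [])] p []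
        (interleave p l) = 0 := by
      refine h.blockSum_eq_zero hB P.moment (acc := [(i₁, a * P.incl (P.moment []))]) ?_ hpm [] ?_
        ⟨_, List.mem_singleton_self _, i₀, by simp, hi⟩
      · intro y hy
        rw [List.mem_singleton.1 hy]
        exact mul_mem ha (hB _ _)
      · intro y hy
        obtain ⟨x, hx, hy⟩ := List.mem_flatMap.1 hy
        rcases List.mem_cons.1 hy with rfl | hy
        · exact ⟨i₁, hl _ hx⟩
        · rw [List.mem_singleton.1 hy]
          exact ⟨i₀, hpm⟩
    have hint := h.blockSum_interleave hB hi hpm (acc := []) (by simp) ha [] hl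
    have hmul := P.blockSum_mul_incl (P.moment_cons_interleave hp hpB b₀ hb₀)
      (fun l hl => P.firstBlockCumulant_map_mul_incl (b₀ : B) hl) [] a [] l
    rw [moment_cons_eq_blockSum, blockSum, List.nil_append, List.nil_append, hz, add_zero]
    exact hint.trans hmul
  have h₃ := h.moment_cons_interleave hB hp hpB hpm hcomm (l := a :: l)
    (fun y hy => by
      rcases List.mem_cons.1 hy with rfl | hy
      · exact ha
      · exact hl y hy) (by simp)
  rw [P.moment_cons_interleave hp hpB b₀ hb₀] at h₃
  have h₄ : Q.moment ((a :: l).map (compressElem hp)) * (b₀ : B) = _ := h₃.trans h₂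
  -- Invertibility of b₀ removes the common right factor.
  rw [Units.mul_left_inj, List.map_cons, moment_cons_eq_blockSum] at h₄
  exact h₄

end Compress

/-! ### The generated subalgebras and the main theorem -/

theorem incl_mem_algGen (P : NCProbSpace B A) (X : Set A) (b : B) : P.incl b ∈ P.algGen X :=
  Algebra.subset_adjoin (Or.inr ⟨b, rfl⟩)

theorem commute_of_mem_algGen_singleton (P : NCProbSpace B A) {p : A}
    (hpB : ∀ b, Commute p (P.incl b)) {a : A} (ha : a ∈ P.algGen {p}) : Commute p a := by
  induction ha using Algebra.adjoin_induction with
  | mem x hx =>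
    rcases hx with rfl | ⟨b, rfl⟩
    · exact Commute.refl _
    · exact hpB b
  | algebraMap r => exact Algebra.commute_algebraMap_right r p
  | add x y _ _ hx hy => exact hx.add_right hy
  | mul x y _ _ hx hy => exact hx.mul_right hy

theorem symmTuple_one (P : NCProbSpace B A) (l : List A) : P.symmTuple 1 l = l := by
  cases l <;> simp [symmTuple]

end NCProbSpace

theorem mainTheorem4 {B A : Type*} [Ring B] [Algebra ℂ B] [Ring A] [Algebra ℂ A]
    (P : NCProbSpace B A) (p : A) (hp : IsIdempotentElem p)
    (hpB : ∀ b, Commute p (P.incl b)) (b₀ : Bˣ) (hb₀ : P.φ p = b₀)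
    (s : ℕ) (x : Fin s → A) (hfree : P.FreeSets ![{p}, Set.range x]) :
    (P.compress hp hpB b₀ hb₀).trivialRTransform (fun i => compressElem hp (x i)) =
      P.symmRTransform (b₀ : B) x := by
  funext w
  have h := P.firstBlockCumulant_compress hp hpB b₀ hb₀ hfree
    (fun i b => P.incl_mem_algGen _ b) (i₀ := 0) (i₁ := 1) (by decide)
    (Algebra.subset_adjoin (Or.inl rfl))
    (fun a ha => P.commute_of_mem_algGen_singleton hpB ha) (l := w.1.map x) (fun y hy => by
      obtain ⟨i, -, rfl⟩ := List.mem_map.1 hy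
      exact Algebra.subset_adjoin (Or.inl ⟨i, rfl⟩))
  rw [List.map_map] at h
  rw [NCProbSpace.trivialRTransform, NCProbSpace.symmRTransform, NCProbSpace.symmRTransform,
    NCProbSpace.symmTuple_one, NCProbSpace.cumulant_eq_firstBlockCumulant,
    NCProbSpace.cumulant_eq_firstBlockCumulant]
  exact h
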